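/- **Setting.** Let $d\ge 1$ and $\rho>0$. For $f$ on $\mathbb R^d$ let $\mathcal Ff(\xi)=\int f(x)e^{2\pi i\xi\cdot x}\,dx$; for $f$ on $\mathbb Z^d$ let $\hat f(\xi)=\sum_{x}f(x)e^{2\pi i\xi\cdot x}$; $\mathcal F^{-1}$ denotes the inverse transform on $\mathbb R^d$ or on $\mathbb T^d=\mathbb R^d/\mathbb Z^d$. For a function $m$ on $\mathbb T^d$ and $f\in\ell^{p}(\mathbb Z^d)$, $\mathcal F^{-1}(m\hat f)$ is the convolution of $\mathcal F^{-1}m$ with $f$. Write $\mathbb N_n=\{1,\dots,n\}$. * $\eta:\mathbb R^d\to[0,1]$ is smooth, $\eta(x)=1$ for $|x|\le 1/(16d)$ and $\eta(x)=0$ for $|x|\ge 1/(8d)$ (Euclidean norm). * $\Theta$ is a multiplier on $\mathbb R^d$ such that for every $p\in(1,\infty)$ there is $\mathbf A_p>0$ with $\|\mathcal F^{-1}(\Theta\mathcal Ff)\|_{L^p}\le\mathbf A_p\|f\|_{L^p}$ for all $f\in L^2\cap L^p(\mathbb R^d)$. * For $N\in\mathbb N$ put $D=\lfloor 2/\rho\rfloor+1$,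 $N_0=\lfloor N^{\rho/2}\rfloor+1$, $Q_0=(N_0!)^D$, and let $\mathbb P_N$ be the set of primes in $(N_0,N]$. For a set $V$ of primes, $\Pi(V)$ is the set of all products $p_1^{\gamma_1}\cdots p_k^{\gamma_k}$ with $1\le k\le D$, distinct $p_l\in V$ and $\gamma_l\in\mathbb N_D$. Let $P_N=\{Qw: Q\mid Q_0,\ w\in\Pi(\mathbb P_N)\cup\{1\}\}$. * $\eta_N(\xi)=\eta(\mathcal E_N^{-1}\xi)$, where $\mathcal E_N$ is a diagonal $d\times d$ matrix with entries in $(0,e^{-N^{2\rho}}]$. Both $\eta_N$ and $\Theta\eta_N$ are supported near $0$ and are regarded as functions on $\mathbb T^d$. * $\Lambda\subseteq\Pi(\mathbb P_N)\cup\{1\}$ has the $\mathcal O$ property: there are $0\le k\le D$ and finite non-empty sets $S_j=\{q_{j,1},\dots,q_{j,\beta_j}\}$, $j\in\mathbb N_k$, of powers $p^{\gamma}$ with $p\in\mathbb P_N$, $\gamma\in\mathbb N_D$, such that $q_{j,s}$ and $q_{j',s'}$ are coprime whenever $(j,s)\ne(j',s')$ and every $w\in\Lambda$ is uniquely a product $q_{1,s_1}\cdots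 q_{k,s_k}$ (with $k=0$ only for $\Lambda\subseteq\{1\}$). * $A_q=\{a\in\mathbb N_q^d:\gcd(q,a_1,\dots,a_d)=1\}$. For $M\subseteq\mathbb N_k$, $M^c=\mathbb N_k\setminus M$, and $\sigma=(s_j)_{j\in M}\in\prod_{j\in M}\mathbb N_{\beta_j}$, the following are subsets of $\mathbb T^d$: $$\mathcal U_M=\Big\{\sum_{j\in M}\frac{a_j}{q_{j,t_j}}: t_j\in\mathbb N_{\beta_j},\ a_j\in A_{q_{j,t_j}}\Big\},\qquad \mathcal V_M^\sigma=\Big\{\sum_{j\in M}\frac{a_j}{q_{j,s_j}}: a_j\in A_{q_{j,s_j}}\Big\},$$ with $\mathcal U_\emptyset=\mathcal V_\emptyset=\{0\}$. * For $u=\sum_{j=1}^k a_j/q_{j,s_j}\in\mathcal U_{\mathbb N_k}$ and $f\in\ell^{2r}(\mathbb Z^d)$ let $f_u=\mathcal F^{-1}(m_u\hat f)$, where $$m_u(\xi)=\mathbf 1_\Lambda(q_{1,s_1}\cdots q_{k,s_k})\sum_{b\in\mathbb N_{Q_0}^d}(\Theta\eta_N)(\xi-b/Q_0-u).$$ * For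 a family $(g_u)_{u\in\mathcal U_{\mathbb N_k}}$ of functions on $\mathbb Z^d$, $$\mathcal S_{M,M}^\sigma(g_u:u\in\mathcal U_{\mathbb N_k})(x)=\Big(\sum_{w\in\mathcal U_{M^c}}\Big|\sum_{v\in\mathcal V_M^\sigma}g_{w+v}(x)\Big|^2\Big)^{1/2}.$$ **Proposition.** For every $\rho>0$ and every integer $r\ge1$ (and $d\ge 1$) there is a constant $C_{\rho,r}>0$, depending only on $\rho$, $r$ and $d$, such that the following holds for all $\eta$, $\Theta$, $(\mathbf A_p)_{p}$, all $N>8^{2r/\rho}$ with $P_N\subseteq[1,e^{N^\rho}]$ (which is the case for all sufficiently large $N$, depending on $\rho$), all $\mathcal E_N$, all $\Lambda$ and $S_1,\dots,S_k$ as above, and all $f\in\ell^{2r}(\mathbb Z^d)$. The series defining $f_u(x)$ converges absolutely for all $u\in\mathcal U_{\mathbb N_k}$ and $x\in\mathbb Z^d$, and for every $M\subseteq\mathbb N_k$ and every $\sigma\in\prod_{j\in M}\mathbb N_{\beta_j}$, $$\big\|\mathcal S_{M,M}^{\sigma}(f_u:u\in\mathcal U_{\mathbb N_k})\big\|_{\ell^{2r}}\le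 C_{\rho,r}\,\mathbf A_{2r}\,\Big\|\mathcal S_{M,M}^{\sigma}\Big(\mathcal F^{-1}\Big(\sum_{b\in\mathbb N_{Q_0}^d}\eta_N(\xi-b/Q_0-u)\hat f(\xi)\Big):u\in\mathcal U_{\mathbb N_k}\Big)\Big\|_{\ell^{2r}}.$$ -/

import Mathlib

open MeasureTheory FourierTransform
open scoped ENNReal ContDiff

noncomputable section

namespace IonescuWainger

/-! ### Fourier multipliers on `ℝ^d` and on `ℤ^d` -/

/-- `ℝ^d` with its Euclidean norm. -/
abbrev Rd (d : ℕ) : Type := EuclideanSpace ℝ (Fin d)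

/-- The integer lattice `ℤ^d`. -/
abbrev Zd (d : ℕ) : Type := Fin d → ℤ

/-- The torus `𝕋^d = (ℝ/ℤ)^d`. -/
abbrev Td (d : ℕ) : Type := UnitAddTorus (Fin d)

/-- `‖𝓕⁻¹(Θ 𝓕 f)‖_p ≤ A ‖f‖_p` for every `f ∈ L² ∩ L^p(ℝ^d)`, where
`𝓕 f(ξ) = ∫ f(x) e^{2πi ξ·x} dx`. With this sign, `𝓕` is Mathlib's `𝓕⁻`; the function
`g = 𝓕⁻¹(Θ 𝓕 f)` is the element of `L²` whose transform is `Θ 𝓕 f`. -/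
def MultiplierBound {d : ℕ} (Θ : Rd d → ℂ) (p A : ℝ) : Prop :=
  ∀ f : Lp ℂ 2 (volume : Measure (Rd d)), MemLp f (ENNReal.ofReal p) volume →
    ∃ g : Lp ℂ 2 (volume : Measure (Rd d)),
      (∀ᵐ ξ, (𝓕⁻ g : Lp ℂ 2 (volume : Measure (Rd d))) ξ =
        Θ ξ * (𝓕⁻ f : Lp ℂ 2 (volume : Measure (Rd d))) ξ) ∧
      eLpNorm g (ENNReal.ofReal p) volume ≤
        ENNReal.ofReal A * eLpNorm f (ENNReal.ofReal p) volume

/-- The representative in `[-1/2, 1/2)^d` of a point of `𝕋^d`. -/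
def torusRep {d : ℕ} (t : Td d) : Rd d :=
  WithLp.toLp 2 fun i => (AddCircle.equivIco (1 : ℝ) (-1 / 2) (t i) : ℝ)

/-- A function on `ℝ^d` (in the applications supported in `(-1/2, 1/2)^d`) regarded as a periodic
function, that is, as a function on `𝕋^d`. -/
def onTorus {d : ℕ} (g : Rd d → ℂ) : Td d → ℂ := fun t => g (torusRep t)

/-- The operator `f ↦ 𝓕⁻¹(m f̂)` on functions on `ℤ^d`: convolution with the kernel
`𝓕⁻¹ m (x) = ∫_{𝕋^d} m(ξ) e^{-2πi x·ξ} dξ`. For `f ∈ ℓ¹` this is literally `𝓕⁻¹(m f̂)`, see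
`latticeMult_eq`; the convolution makes sense for `f ∈ ℓ^p` as well, if `𝓕⁻¹ m ∈ ℓ^{p'}`. -/
def latticeMult {d : ℕ} (m : Td d → ℂ) (f : Zd d → ℂ) (x : Zd d) : ℂ :=
  ∑' y : Zd d, UnitAddTorus.mFourierCoeff m (x - y) * f y

/-- For `f ∈ ℓ¹(ℤ^d)` with `f̂(ξ) = ∑ f(y) e^{2πi ξ·y}` and integrable `m`, the operator above is
`x ↦ ∫_{𝕋^d} m(ξ) f̂(ξ) e^{-2πi x·ξ} dξ`. -/
theorem latticeMult_eq {d : ℕ} (m : Td d → ℂ)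
    (hm : Integrable m (Measure.pi fun _ : Fin d => AddCircle.haarAddCircle))
    (f : Zd d → ℂ) (hf : Summable f) (x : Zd d) :
    latticeMult m f x =
      UnitAddTorus.mFourierCoeff (fun t => m t * ∑' y, f y * UnitAddTorus.mFourier y t) x := by
  set μ : Measure (Td d) := Measure.pi fun _ : Fin d => AddCircle.haarAddCircle with hμ
  have key : ∀ (g : Td d → ℂ) (z : Zd d), UnitAddTorus.mFourierCoeff g z =
      ∫ t, UnitAddTorus.mFourier (-z) t * g t ∂μ := fun g z => rfl
  have h1 : ∀ (z : Zd d) (t : Td d), ‖UnitAddTorus.mFourier z t‖ = 1 := by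
    intro z t
    simp [UnitAddTorus.mFourier, norm_prod, Circle.norm_coe]
  have hint : ∀ z : Zd d, Integrable (fun t => UnitAddTorus.mFourier z t * m t) μ := by
    intro z
    refine hm.bdd_mul (c := 1) ?_ (Filter.Eventually.of_forall fun t => (h1 z t).le)
    exact (UnitAddTorus.mFourier z).continuous.aestronglyMeasurable
  have hsum : HasSum
      (fun y => ∫ t, UnitAddTorus.mFourier (-(x - y)) t * m t * f y ∂μ)
      (∫ t, ∑' y, UnitAddTorus.mFourier (-(x - y)) t * m t * f y ∂μ) := by
    refine hasSum_integral_of_summable_integral_norm (fun y => (hint _).mul_const _) ?_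
    have : ∀ y, ∫ t, ‖UnitAddTorus.mFourier (-(x - y)) t * m t * f y‖ ∂μ =
        (∫ t, ‖m t‖ ∂μ) * ‖f y‖ := by
      intro y
      simp only [norm_mul, h1, one_mul]
      exact integral_mul_const _ _
    simp only [this]
    exact hf.norm.mul_left _
  rw [latticeMult, key]
  simp only [key, ← integral_mul_const]
  rw [hsum.tsum_eq]
  congr 1
  ext t
  rw [← tsum_mul_left, ← tsum_mul_left]
  congr 1
  ext y
  have : -(x - y) = -x + y := by abel
  rw [this, UnitAddTorus.mFourier_add]
  ring

/-! ### The cutoff functions -/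

/-- A smooth function `0 ≤ η ≤ 1` with `η = 1` on `|x| ≤ 1/(16 d)` and `η = 0` on
`|x| ≥ 1/(8 d)`. -/
structure IsCutoff (d : ℕ) (η : Rd d → ℝ) : Prop where
  smooth : ContDiff ℝ ∞ η
  nonneg : ∀ x, 0 ≤ η x
  le_one : ∀ x, η x ≤ 1
  eq_one : ∀ x, ‖x‖ ≤ 1 / (16 * (d : ℝ)) → η x = 1
  eq_zero : ∀ x, 1 / (8 * (d : ℝ)) ≤ ‖x‖ → η x = 0

/-- `η_N(ξ) = η(𝓔⁻¹ ξ)`, where `𝓔` is the diagonal matrix with entries `ε`. -/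
def scaledCutoff {d : ℕ} (η : Rd d → ℝ) (ε : Fin d → ℝ) : Rd d → ℝ :=
  fun ξ => η (WithLp.toLp 2 fun i => (ε i)⁻¹ * ξ i)

/-! ### The arithmetic sets -/

/-- `D = ⌊2/ρ⌋ + 1`. -/
def bigD (ρ : ℝ) : ℕ := ⌊2 / ρ⌋₊ + 1

/-- `N₀ = ⌊N^{ρ/2}⌋ + 1`. -/
def N0 (ρ : ℝ) (N : ℕ) : ℕ := ⌊(N : ℝ) ^ (ρ / 2)⌋₊ + 1

/-- `Q₀ = (N₀!)^D`. -/
def Q0 (ρ : ℝ) (N : ℕ) : ℕ := (N0 ρ N).factorial ^ bigD ρ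

/-- `ℙ_N = ℙ ∩ (N₀, N]`. -/
def primesN (ρ : ℝ) (N : ℕ) : Set ℕ := {p | p.Prime ∧ N0 ρ N < p ∧ p ≤ N}

/-- `Π(V)`: the products of `k` powers of distinct elements of `V`, with `1 ≤ k ≤ D` and all
exponents between `1` and `D`. -/
def PiSet (D : ℕ) (V : Set ℕ) : Set ℕ :=
  {w | ∃ (T : Finset ℕ) (γ : ℕ → ℕ), (T : Set ℕ) ⊆ V ∧ 1 ≤ T.card ∧ T.card ≤ D ∧
    (∀ p ∈ T, 1 ≤ γ p ∧ γ p ≤ D) ∧ w = ∏ p ∈ T, p ^ γ p}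

/-- `P_N = {Q w : Q ∣ Q₀, w ∈ Π(ℙ_N) ∪ {1}}`. -/
def PN (ρ : ℝ) (N : ℕ) : Set ℕ :=
  {n | ∃ Q w : ℕ, Q ∣ Q0 ρ N ∧ w ∈ PiSet (bigD ρ) (primesN ρ N) ∪ {1} ∧ n = Q * w}

/-- The sets `S_j = {q_{j,1}, …, q_{j,β_j}}`, `1 ≤ j ≤ k`, witness the `𝓞` property of `Λ` with
respect to `V`; the case `k = 0`, an empty family, occurs for `Λ = {1}`. -/
structure IsOSystem (D : ℕ) (V Λ : Set ℕ) (k : ℕ) (β : Fin k → ℕ)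
    (q : (j : Fin k) → Fin (β j) → ℕ) : Prop where
  k_le : k ≤ D
  β_pos : ∀ j, 1 ≤ β j
  prime_pow : ∀ j s, ∃ p ∈ V, ∃ γ : ℕ, 1 ≤ γ ∧ γ ≤ D ∧ q j s = p ^ γ
  factor : ∀ w ∈ Λ, ∃! s : (j : Fin k) → Fin (β j), w = ∏ j, q j (s j)
  coprime : ∀ (j j' : Fin k) (s : Fin (β j)) (s' : Fin (β j')),
    (⟨j, s⟩ : Σ i, Fin (β i)) ≠ ⟨j', s'⟩ → Nat.Coprime (q j s) (q j' s')

/-- `ℕ_q^d = {1, …, q}^d`. -/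
def box (d q : ℕ) : Finset (Fin d → ℕ) := Fintype.piFinset fun _ => Finset.Icc 1 q

/-- `A_q`: the `a ∈ ℕ_q^d` with `gcd(q, a_1, …, a_d) = 1`. -/
def Aset (d q : ℕ) : Finset (Fin d → ℕ) :=
  (box d q).filter fun a => Nat.gcd q (Finset.univ.gcd a) = 1

/-- The point `a/q` of `𝕋^d`. -/
def ratPt {d : ℕ} (q : ℕ) (a : Fin d → ℕ) : Td d :=
  fun i => (((a i : ℝ) / (q : ℝ) : ℝ) : UnitAddCircle)

section Frequencies

variable (d : ℕ) {k : ℕ} {β : Fin k → ℕ} (q : (j : Fin k) → Fin (β j) → ℕ)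

open scoped Classical in
/-- `𝓤_{j} = {a/q_{j,s} ∈ 𝕋^d : 1 ≤ s ≤ β_j, a ∈ A_{q_{j,s}}}`. -/
def Usingle (j : Fin k) : Finset (Td d) :=
  Finset.univ.biUnion fun s : Fin (β j) => (Aset d (q j s)).image (ratPt (q j s))

open scoped Classical in
/-- `𝓤_M = {∑_{j ∈ M} u_j : u_j ∈ 𝓤_{j}} ⊆ 𝕋^d`; in particular `𝓤_∅ = {0}`. -/
def U (M : Finset (Fin k)) : Finset (Td d) :=
  (Fintype.piFinset fun j : M => Usingle d q j).image fun u => ∑ j, u j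

open scoped Classical in
/-- `𝓥_M^σ = {∑_{j ∈ M} a_j/q_{j,σ_j} : a_j ∈ A_{q_{j,σ_j}}} ⊆ 𝕋^d`; in particular
`𝓥_∅ = {0}`. -/
def V (M : Finset (Fin k)) (σ : (j : M) → Fin (β j)) : Finset (Td d) :=
  (Fintype.piFinset fun j : M => (Aset d (q j (σ j))).image (ratPt (q j (σ j)))).image
    fun u => ∑ j, u j

open scoped Classical in
/-- For `u = a_1/q_{1,s_1} + … + a_k/q_{k,s_k}` with `a_j ∈ A_{q_{j,s_j}}`, the value
`𝟙_Λ(q_{1,s_1} ⋯ q_{k,s_k})`. (The indices `s_j` are determined by `u`.) -/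
def chi (Λ : Set ℕ) (u : Td d) : ℂ :=
  if ∃ s : (j : Fin k) → Fin (β j), u ∈ V d q Finset.univ (fun j => s j) ∧ ∏ j, q j (s j) ∈ Λ
  then 1 else 0

/-- The square function
`𝓢_{L,M}^σ(F)(x) = (∑_{w ∈ 𝓤_{M^c}} |∑_{u ∈ 𝓤_{M∖L}} ∑_{v ∈ 𝓥_L^σ} F_{w+u+v}(x)|²)^{1/2}`
of a family `F` of functions on `ℤ^d`. -/
def squareFn (L M : Finset (Fin k)) (σ : (j : L) → Fin (β j)) (F : Td d → Zd d → ℂ)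
    (x : Zd d) : ℝ :=
  Real.sqrt (∑ w ∈ U d q Mᶜ, ‖∑ u ∈ U d q (M \ L), ∑ v ∈ V d q L σ, F (w + u + v) x‖ ^ 2)

end Frequencies

/-- `ξ ↦ ∑_{b ∈ ℕ_Q^d} g(ξ - b/Q - u)`, with `g` regarded as a periodic function. -/
def shiftSum {d : ℕ} (Q : ℕ) (g : Rd d → ℂ) (u : Td d) : Td d → ℂ :=
  fun ξ => ∑ b ∈ box d Q, onTorus g (ξ - ratPt Q b - u)

/-- The multiplier
`m_u(ξ) = 𝟙_Λ(q_{1,s_1} ⋯ q_{k,s_k}) ∑_{b ∈ ℕ_Q^d} Θ(ξ - b/Q - u) η_N(ξ - b/Q - u)`. -/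
def mult {d k : ℕ} {β : Fin k → ℕ} (q : (j : Fin k) → Fin (β j) → ℕ) (Λ : Set ℕ) (Q : ℕ)
    (Θ : Rd d → ℂ) (ηN : Rd d → ℝ) (u : Td d) : Td d → ℂ :=
  fun ξ => chi d q Λ u * shiftSum Q (fun ζ => Θ ζ * (ηN ζ : ℂ)) u ξ

end IonescuWainger

end

/-! Fix `M` and `σ`, and put `Q = Q0 * n` with `n` the product of the `q j (σ j)`, `j ∈ M`. Every `v
∈ 𝓥_M^σ` and every `b/Q₀` is a `Q`-torsion point of the torus. Moreover `Q ∈ P_N`, so `Q ≤ e^{N^ρ}`,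
while the entries of `𝓔_N` are at most `e^{-N^{2ρ}}`; hence `|Qξ| ≤ 1/8` on the support of `η_N`.

Let `c` be a bump equal to `1` on the ball of radius `1/8` and vanishing outside that of radius
`1/4`, and let `K_w(ξ) = ∑_b Θ(ξ-b/Q-w) c(Q(ξ-b/Q-w))`, `b ∈ ℕ_Q^d`. Distinct `Q`-torsion points are
`1/Q`-separated in some coordinate, so on each bump of `η_N` exactly one term of `K_w` survives.
This gives, for each `w`, the factorization (`shiftSum_mul_sum_shiftSum`) `∑_v ∑_b
(Θη_N)(ξ-b/Q₀-w-v) = K_w(ξ) ∑_v ∑_b η_N(ξ-b/Q₀-w-v)`. The sum over `v` on the left of the estimate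
is thus the operator `K_w` applied to the corresponding sum on the right. The factor `𝟙_Λ` does not
depend on `v`, because the order of `w+v` in the torus is the product of its denominators
(`IsOSystem.exists_chi_eq`).

Up to modulations, which do not change absolute values, all `K_w` are the single operator `K_0`. So
it suffices to bound `K_0` on `ℓ^{2r}` and to extend the bound to square functions by Khinchine's
inequality (`marcinkiewicz_zygmund`).

The kernel of `K_0` lives on `Qℤ^d`, so residue classes mod `Q` decouple
(`tsum_convolution_le_of_residues`). On one class, transference from `ℝ^d` applies
(`exists_transference`): a sequence is synthesized into a band-limited function, `Θ` acts on it, and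
the result is sampled on `Qℤ^d`. Both passages are Schur tests (`exists_synthesis`,
`exists_sampling`), and the powers of `Q` cancel, so the bound is a constant times `A_{2r}`,
uniformly in `Q`.

Since `f` is only in `ℓ^{2r}`, convergence rests on the kernels lying in the dual `ℓ^q`. This uses
the multiplier bound at the exponent `q`, but only qualitatively: `A_q` does not enter the constant.
-/

open MeasureTheory FourierTransform
open scoped ENNReal ContDiff

noncomputable section

namespace IonescuWainger

/-! ### The Schur test -/

section Schur

variable {α β : Type*} [MeasurableSpace α] [MeasurableSpace β]

/-- Jensen's inequality in the form `(∫ k g)^p ≤ (∫ k)^{p-1} ∫ k g^p`. -/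
theorem lintegral_mul_rpow_le {ν : Measure β} {p : ℝ} (hp : 1 < p) {k g : β → ℝ≥0∞}
    (hk : AEMeasurable k ν) (hg : AEMeasurable g ν) :
    (∫⁻ y, k y * g y ∂ν) ^ p ≤ (∫⁻ y, k y ∂ν) ^ (p - 1) * ∫⁻ y, k y * g y ^ p ∂ν := by
  have hpq : p.HolderConjugate (Real.conjExponent p) := Real.HolderConjugate.conjExponent hp
  set s := Real.conjExponent p with hs
  have hp0 : 0 < p := by linarith
  have hs0 : 0 < s := hpq.symm.pos
  have h1 : ∀ y, k y * g y = k y ^ (1 / s) * (k y ^ (1 / p) * g y) := by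
    intro y
    rw [← mul_assoc, ← ENNReal.rpow_add_of_nonneg _ _ (by positivity) (by positivity)]
    have : 1 / s + 1 / p = 1 := by simpa [one_div, add_comm] using hpq.inv_add_inv_eq_one
    rw [this, ENNReal.rpow_one]
  have h2 := ENNReal.lintegral_mul_le_Lp_mul_Lq ν hpq.symm (f := fun y => k y ^ (1 / s))
    (g := fun y => k y ^ (1 / p) * g y) (hk.pow_const _) ((hk.pow_const _).mul hg)
  have h3 : ∀ y, (k y ^ (1 / s)) ^ s = k y := fun y => by
    rw [← ENNReal.rpow_mul, one_div, inv_mul_cancel₀ hs0.ne', ENNReal.rpow_one]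
  have h4 : ∀ y, (k y ^ (1 / p) * g y) ^ p = k y * g y ^ p := fun y => by
    rw [ENNReal.mul_rpow_of_nonneg _ _ hp0.le, ← ENNReal.rpow_mul, one_div,
      inv_mul_cancel₀ hp0.ne', ENNReal.rpow_one]
  simp only [Pi.mul_apply, h3, h4, ← h1] at h2
  calc (∫⁻ y, k y * g y ∂ν) ^ p
      ≤ ((∫⁻ y, k y ∂ν) ^ (1 / s) * (∫⁻ y, k y * g y ^ p ∂ν) ^ (1 / p)) ^ p := by gcongr
    _ = _ := by
      rw [ENNReal.mul_rpow_of_nonneg _ _ hp0.le, ← ENNReal.rpow_mul, ← ENNReal.rpow_mul]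
      congr 2
      · rw [hs, Real.conjExponent]; field_simp
      · rw [one_div, inv_mul_cancel₀ hp0.ne', ENNReal.rpow_one]

/-- The Schur test on `L^p`, `1 < p < ∞`. -/
theorem schur_test {μ : Measure α} {ν : Measure β} [SFinite μ] [SFinite ν] {p : ℝ} (hp : 1 < p)
    {k : α → β → ℝ≥0∞} (hk : Measurable (Function.uncurry k))
    {g : β → ℝ≥0∞} (hg : AEMeasurable g ν) {a b : ℝ≥0∞}
    (ha : ∀ x, ∫⁻ y, k x y ∂ν ≤ a) (hb : ∀ y, ∫⁻ x, k x y ∂μ ≤ b) :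
    ∫⁻ x, (∫⁻ y, k x y * g y ∂ν) ^ p ∂μ ≤ a ^ (p - 1) * b * ∫⁻ y, g y ^ p ∂ν := by
  have hp0 : 0 ≤ p - 1 := by linarith
  calc ∫⁻ x, (∫⁻ y, k x y * g y ∂ν) ^ p ∂μ
      ≤ ∫⁻ x, a ^ (p - 1) * ∫⁻ y, k x y * g y ^ p ∂ν ∂μ := by
        refine lintegral_mono fun x => ?_
        refine (lintegral_mul_rpow_le hp ?_ hg).trans ?_
        · exact (hk.comp measurable_prodMk_left).aemeasurable
        · gcongr; exact ha x
    _ = a ^ (p - 1) * ∫⁻ y, ∫⁻ x, k x y * g y ^ p ∂μ ∂ν := by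
        have hm : AEMeasurable (Function.uncurry fun x y => k x y * g y ^ p) (μ.prod ν) :=
          hk.aemeasurable.mul ((hg.pow_const p).comp_snd)
        rw [lintegral_const_mul'' _ hm.lintegral_prod_right, lintegral_lintegral_swap hm]
    _ ≤ a ^ (p - 1) * ∫⁻ y, b * g y ^ p ∂ν := by
        gcongr with y
        rw [lintegral_mul_const]
        · gcongr; exact hb y
        · exact hk.comp measurable_prodMk_right
    _ = _ := by
        rw [lintegral_const_mul'' _ (hg.pow_const p), mul_assoc]

end Schur

/-! ### Lattice sums of Schwartz functions -/

/-- The inclusion `ℤ^d → ℝ^d`. -/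
def latticePt {d : ℕ} (n : Zd d) : Rd d := WithLp.toLp 2 fun i => (n i : ℝ)

theorem latticePt_sub {d : ℕ} (m n : Zd d) : latticePt (m - n) = latticePt m - latticePt n := by
  ext i; simp [latticePt]

theorem sum_prod_le_tsum_pow {d : ℕ} {w : ℤ → ℝ} (hw : ∀ n, 0 ≤ w n) (hs : Summable w)
    (X : Finset (Zd d)) : ∑ n ∈ X, ∏ i, w (n i) ≤ (∑' n, w n) ^ d := by
  classical
  set Y : Finset ℤ := Finset.univ.biUnion fun i => X.image fun n => n i
  calc ∑ n ∈ X, ∏ i, w (n i) ≤ ∑ n ∈ Fintype.piFinset (fun _ : Fin d => Y), ∏ i, w (n i) := by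
        refine Finset.sum_le_sum_of_subset_of_nonneg (fun n hn => ?_)
          (fun _ _ _ => Finset.prod_nonneg fun _ _ => hw _)
        simp only [Fintype.mem_piFinset, Y, Finset.mem_biUnion, Finset.mem_image]
        exact fun i => ⟨i, Finset.mem_univ _, n, hn, rfl⟩
    _ = (∑ m ∈ Y, w m) ^ d := by
        rw [Finset.sum_prod_piFinset Y (fun _ m => w m)]; simp
    _ ≤ _ := by
        gcongr
        · exact Finset.sum_nonneg fun _ _ => hw _
        · exact hs.sum_le_tsum _ fun _ _ => hw _

/-- Decay in product form lets lattice sums factor over the coordinates; `(1 + ‖x‖)^(2d)` dominates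
the product. -/
theorem exists_norm_mul_prod_le {d : ℕ} (φ : SchwartzMap (Rd d) ℂ) :
    ∃ C : ℝ, 0 ≤ C ∧ ∀ x, ‖φ x‖ * ∏ i, (1 + x i ^ 2) ≤ C := by
  obtain ⟨C, hC⟩ : ∃ C : ℝ, ∀ x, (1 + ‖x‖) ^ (2 * d) * ‖φ x‖ ≤ C := by
    refine ⟨2 ^ (2 * d) * ((Finset.Iic (2 * d, 0)).sup
      fun m => SchwartzMap.seminorm ℝ m.1 m.2) φ, fun x => ?_⟩
    simpa using SchwartzMap.one_add_le_sup_seminorm_apply (𝕜 := ℝ) (m := (2 * d, 0)) le_rfl le_rfl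
      φ x
  refine ⟨C, ?_, fun x => ?_⟩
  · exact (by positivity : (0:ℝ) ≤ (1 + ‖(0 : Rd d)‖) ^ (2 * d) * ‖φ 0‖).trans (hC 0)
  · refine le_trans ?_ (hC x)
    rw [mul_comm]
    gcongr
    calc ∏ i, (1 + x i ^ 2) ≤ ∏ i : Fin d, (1 + ‖x‖) ^ 2 := by
          refine Finset.prod_le_prod (fun i _ => by positivity) fun i _ => ?_
          have h1 : |x i| ≤ ‖x‖ := by simpa using PiLp.norm_apply_le x i
          have h2 : x i ^ 2 ≤ ‖x‖ ^ 2 := sq_le_sq.2 (by simpa using h1)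
          nlinarith [norm_nonneg x]
      _ = _ := by simp [← pow_mul, mul_comm]

theorem exists_tsum_enorm_le {d : ℕ} (φ : SchwartzMap (Rd d) ℂ) :
    ∃ C : ℝ≥0∞, C ≠ ⊤ ∧ ∀ t : Rd d, ∑' n : Zd d, ‖φ (latticePt n - t)‖ₑ ≤ C := by
  obtain ⟨C, hC0, hC⟩ := exists_norm_mul_prod_le φ
  -- The factor `3` absorbs a shift by a fractional part: `1 + n² ≤ 3 (1 + (n - θ)²)` for `0 ≤ θ <
  -- 1`.
  set w : ℤ → ℝ := fun n => 3 * (1 + (n : ℝ) ^ 2)⁻¹ with hw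
  have hw0 : ∀ n, 0 ≤ w n := fun n => by positivity
  have hws : Summable w := by
    refine Summable.mul_left _ ?_
    refine Summable.of_nonneg_of_le (fun n => by positivity) (fun n => ?_)
      ((Real.summable_one_div_int_pow.2 one_lt_two).add (summable_of_hasFiniteSupport
        (f := fun n : ℤ => if n = 0 then (1 : ℝ) else 0) ((Set.finite_singleton 0).subset ?_)))
    · by_cases h : n = 0
      · simp [h]
      · have : (0 : ℝ) < (n : ℝ) ^ 2 := by positivity
        simp only [h, if_false, add_zero, one_div]
        gcongr; linarith
    · intro n; simp
  refine ⟨ENNReal.ofReal (C * (∑' n, w n) ^ d), ENNReal.ofReal_ne_top, fun t => ?_⟩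
  -- Translating the sum by the integer part of `t` leaves only its fractional part, whence a bound
  -- uniform in `t`.
  set s : Zd d := fun i => ⌊t i⌋ with hsdef
  rw [← (Equiv.addRight s).tsum_eq]
  refine ENNReal.summable.tsum_le_of_sum_le fun X => ?_
  have key : ∀ n : Zd d, ‖φ (latticePt (n + s) - t)‖ ≤ C * ∏ i, w (n i) := by
    intro n
    set x := latticePt (n + s) - t
    have h1 : ∀ i, (1 + x i ^ 2)⁻¹ ≤ w (n i) := by
      intro i
      have hx : x i = n i - Int.fract (t i) := by
        simp only [x, latticePt, hsdef, PiLp.sub_apply, Pi.add_apply, Int.fract]; push_cast; ring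
      have := Int.fract_nonneg (t i)
      have := Int.fract_lt_one (t i)
      rw [hx, hw]
      simp only
      rw [← div_eq_mul_inv, inv_le_comm₀ (by positivity) (by positivity), inv_div,
        div_le_iff₀ (by norm_num)]
      nlinarith [sq_nonneg ((n i : ℝ) - 2 * Int.fract (t i))]
    calc ‖φ x‖ = ‖φ x‖ * (∏ i, (1 + x i ^ 2)) * ∏ i, (1 + x i ^ 2)⁻¹ := by
          rw [mul_assoc, ← Finset.prod_mul_distrib]
          rw [Finset.prod_eq_one fun i _ => mul_inv_cancel₀ (by positivity)]; simp
      _ ≤ C * ∏ i, w (n i) := by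
          gcongr
          · exact hC x
          · exact h1 _
  calc ∑ n ∈ X, ‖φ (latticePt (Equiv.addRight s n) - t)‖ₑ
      ≤ ∑ n ∈ X, ENNReal.ofReal (C * ∏ i, w (n i)) := by
        gcongr with n
        rw [← ofReal_norm]
        exact ENNReal.ofReal_le_ofReal (key n)
    _ = ENNReal.ofReal (∑ n ∈ X, C * ∏ i, w (n i)) := by
        rw [ENNReal.ofReal_sum_of_nonneg]
        exact fun n _ => mul_nonneg hC0 (Finset.prod_nonneg fun _ _ => hw0 _)
    _ ≤ _ := by
        rw [← Finset.mul_sum]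
        gcongr
        exact sum_prod_le_tsum_pow hw0 hws X

/-! ### Band-limited functions -/

section BandLimited

variable {d : ℕ} {Θ : Rd d → ℂ} {b c : Rd d → ℂ}

/-- The hypothesis is applied to the Schwartz function `𝓕 b`, whose inverse transform is `b`.
Nothing is assumed about the regularity of `Θ`, so `𝓕(Θb)` enters first as an element `g` of `L²`.
-/
theorem MultiplierBound.exists_Lp {p A : ℝ} (hΘ : MultiplierBound Θ p A) (hb : ContDiff ℝ ∞ b)
    (hb' : HasCompactSupport b) :
    ∃ g : Lp ℂ 2 (volume : Measure (Rd d)),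
      (∀ᵐ ξ, (𝓕⁻ g : Lp ℂ 2 (volume : Measure (Rd d))) ξ = Θ ξ * b ξ) ∧
      eLpNorm g (ENNReal.ofReal p) volume ≤
        ENNReal.ofReal A * eLpNorm (𝓕 b) (ENNReal.ofReal p) volume := by
  set B : SchwartzMap (Rd d) ℂ := hb'.toSchwartzMap hb with hB
  have hae := (𝓕 B).coeFn_toLp 2 (volume : Measure (Rd d))
  have hBb : ((𝓕 B : SchwartzMap (Rd d) ℂ) : Rd d → ℂ) = 𝓕 b := SchwartzMap.fourier_coe B
  have hmem : MemLp ((𝓕 B).toLp 2 (volume : Measure (Rd d))) (ENNReal.ofReal p) volume :=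
    ((𝓕 B).memLp (ENNReal.ofReal p)).ae_eq hae.symm
  obtain ⟨g, hg, hg'⟩ := hΘ _ hmem
  refine ⟨g, ?_, ?_⟩
  · rw [SchwartzMap.toLp_fourierInv_eq, fourierInv_fourier_eq] at hg
    filter_upwards [hg, B.coeFn_toLp 2 (volume : Measure (Rd d))] with ξ h1 h2
    rw [h1, h2]; rfl
  · rwa [eLpNorm_congr_ae hae, hBb] at hg'

/-- `Θb` is in `L²` and vanishes off a set of finite measure. Consequently the kernel `𝓕(Θb)` is
defined pointwise. -/
theorem MultiplierBound.integrable {p A : ℝ} (hΘ : MultiplierBound Θ p A) (hb : ContDiff ℝ ∞ b)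
    (hb' : HasCompactSupport b) : Integrable fun ξ => Θ ξ * b ξ := by
  obtain ⟨g, hg, -⟩ := hΘ.exists_Lp hb hb'
  have h2 : MemLp (fun ξ => Θ ξ * b ξ) 2 (volume : Measure (Rd d)) := (Lp.memLp (𝓕⁻ g)).ae_eq hg
  have hfin : IsFiniteMeasure ((volume : Measure (Rd d)).restrict (tsupport b)) :=
    ⟨by simpa using hb'.isCompact.measure_lt_top⟩
  have h3 : IntegrableOn (fun ξ => Θ ξ * b ξ) (tsupport b) :=
    (h2.restrict (tsupport b)).integrable (by norm_num)
  rwa [integrableOn_iff_integrable_of_support_subset] at h3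
  intro ξ hξ
  exact subset_tsupport _ (right_ne_zero_of_mul hξ)

/-- The reproducing formula `𝓕(Θb) = g * 𝓕 c` for band-limited functions, when `c = 1` on the
support of `b`. -/
theorem fourier_mul_eq_convolution {g : Lp ℂ 2 (volume : Measure (Rd d))}
    (hg : ∀ᵐ ξ, (𝓕⁻ g : Lp ℂ 2 (volume : Measure (Rd d))) ξ = Θ ξ * b ξ)
    (hc : ContDiff ℝ ∞ c) (hc' : HasCompactSupport c) (hcb : ∀ ξ, c ξ * b ξ = b ξ) (x : Rd d) :
    𝓕 (fun ξ => Θ ξ * b ξ) x = ∫ y, g y * 𝓕 c (x - y) := by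
  set e : Rd d → ℂ := fun ξ => Complex.exp (2 * Real.pi * Complex.I * (inner ℝ ξ x : ℝ)) with he
  have hesm : ContDiff ℝ ∞ e := by
    have : ContDiff ℝ ∞ fun ξ : Rd d => ((inner ℝ ξ x : ℝ) : ℂ) :=
      Complex.ofRealCLM.contDiff.comp (contDiff_id.inner ℝ contDiff_const)
    exact (contDiff_const.mul this).cexp
  -- Parseval against this test function: pairing it with `𝓕⁻ g = Θb` gives `𝓕(cΘb)(x)`, and the
  -- conjugate of its transform at `y` is `𝓕 c (x - y)`.
  set h : Rd d → ℂ := fun ξ => (starRingEnd ℂ) (c ξ) * e ξ with hh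
  have hsm : ContDiff ℝ ∞ h := ((Complex.conjCLE.contDiff).comp hc).mul hesm
  have hcs : HasCompactSupport h :=
    (hc'.comp_left (g := starRingEnd ℂ) (map_zero _)).mul_right
  set H : SchwartzMap (Rd d) ℂ := hcs.toSchwartzMap hsm with hH
  have key : inner ℂ ((𝓕 H).toLp 2 (volume : Measure (Rd d))) g =
      inner ℂ (H.toLp 2 (volume : Measure (Rd d))) (𝓕⁻ g) := by
    have hgg : 𝓕 (𝓕⁻ g : Lp ℂ 2 (volume : Measure (Rd d))) = g := fourier_fourierInv_eq g
    conv_lhs => rw [← SchwartzMap.toLp_fourier_eq, ← hgg]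
    rw [Lp.inner_fourier_eq]
  rw [L2.inner_def, L2.inner_def] at key
  have hL : ∀ y, (starRingEnd ℂ) ((𝓕 H) y) = 𝓕 c (x - y) := by
    intro y
    rw [SchwartzMap.fourier_coe, Real.fourier_eq', Real.fourier_eq', ← integral_conj]
    congr 1
    ext ξ
    change (starRingEnd ℂ) (_ • h ξ) = _
    simp only [hh, he, smul_eq_mul, map_mul, Complex.conj_conj, ← Complex.exp_conj, Complex.conj_I,
      Complex.conj_ofReal, map_ofNat]
    rw [inner_sub_right, mul_left_comm, mul_comm, ← Complex.exp_add]
    congr 2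
    push_cast
    simp
    ring
  calc 𝓕 (fun ξ => Θ ξ * b ξ) x
      = ∫ ξ, inner ℂ (H.toLp 2 (volume : Measure (Rd d)) ξ) ((𝓕⁻ g : Lp ℂ 2 _) ξ) := by
        rw [Real.fourier_eq']
        refine integral_congr_ae ?_
        filter_upwards [hg, H.coeFn_toLp 2 (volume : Measure (Rd d))] with ξ h1 h2
        rw [h1, h2]
        change _ = inner ℂ (h ξ) _
        simp only [hh, he, smul_eq_mul, RCLike.inner_apply, map_mul, Complex.conj_conj,
          ← Complex.exp_conj, Complex.conj_I, Complex.conj_ofReal, map_ofNat]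
        rw [show Θ ξ * b ξ = Θ ξ * (c ξ * b ξ) by rw [hcb]]
        have : ((-2 * Real.pi * inner ℝ ξ x : ℝ) : ℂ) * Complex.I =
          2 * Real.pi * -Complex.I * (inner ℝ ξ x : ℝ) := by push_cast; ring
        rw [this, hcb]
        linear_combination (-Complex.exp (2 * Real.pi * -Complex.I * (inner ℝ ξ x : ℝ)) * Θ ξ) *
          hcb ξ
    _ = ∫ y, inner ℂ ((𝓕 H).toLp 2 (volume : Measure (Rd d)) y) (g y) := key.symm
    _ = _ := by
        refine integral_congr_ae ?_
        filter_upwards [(𝓕 H).coeFn_toLp 2 (volume : Measure (Rd d))] with y h1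
        rw [h1, ← hL y]
        simp [RCLike.inner_apply]

end BandLimited

/-! ### Dilated cutoffs and the transference principle -/

section Transference

variable {d : ℕ}

/-- The dilate `ξ ↦ c(Qξ)`. -/
def dilate (Q : ℕ) (c : Rd d → ℂ) : Rd d → ℂ := fun ξ => c ((Q : ℝ) • ξ)

theorem contDiff_dilate {c : Rd d → ℂ} (hc : ContDiff ℝ ∞ c) (Q : ℕ) :
    ContDiff ℝ ∞ (dilate Q c) := hc.comp (contDiff_const_smul _)

theorem hasCompactSupport_dilate {c : Rd d → ℂ} (hc : HasCompactSupport c) {Q : ℕ} (hQ : Q ≠ 0) :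
    HasCompactSupport (dilate Q c) := hc.comp_smul (by exact_mod_cast hQ)

theorem fourier_dilate (c : Rd d → ℂ) (Q : ℕ) (hQ : Q ≠ 0) (x : Rd d) :
    𝓕 (dilate Q c) x = ((Q : ℂ) ^ d)⁻¹ * 𝓕 c ((Q : ℝ)⁻¹ • x) := by
  have hQ' : (Q : ℝ) ≠ 0 := by exact_mod_cast hQ
  rw [Real.fourier_eq', Real.fourier_eq']
  have := Measure.integral_comp_smul (volume : Measure (Rd d))
    (fun v => Complex.exp (((-2 * Real.pi * inner ℝ v ((Q : ℝ)⁻¹ • x) : ℝ) : ℂ) * Complex.I) • c v)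
    (Q : ℝ)
  rw [finrank_euclideanSpace_fin, abs_of_nonneg (by positivity)] at this
  rw [show ((Q : ℂ) ^ d)⁻¹ * _ = (((Q : ℝ) ^ d)⁻¹ : ℝ) • _ from ?_, ← this]
  · congr 1
    ext v
    simp only [dilate, real_inner_smul_left, real_inner_smul_right]
    congr 4
    field_simp
  · rw [Complex.real_smul]; push_cast; rfl

/-- `𝓕(c(Q·))(x) = Q^{-d} 𝓕c(x/Q)` is an `L¹`-normalized dilate, so its `L¹` norm is independent of
`Q`, whereas sampling it on a translate of `Qℤ^d` costs `Q^{-d}` times a unit lattice sum. These are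
the two inputs of the Schur tests. -/
theorem exists_kernel_bounds {c : Rd d → ℂ} (hc : ContDiff ℝ ∞ c) (hc' : HasCompactSupport c) :
    ∃ I S : ℝ≥0∞, I ≠ ⊤ ∧ S ≠ ⊤ ∧ ∀ Q : ℕ, Q ≠ 0 →
      (∫⁻ x, ‖𝓕 (dilate Q c) x‖ₑ) ≤ I ∧
      ∀ t : Rd d, ∑' n : Zd d, ‖𝓕 (dilate Q c) (latticePt ((Q : ℤ) • n) - t)‖ₑ ≤
        ((Q : ℝ≥0∞) ^ d)⁻¹ * S := by
  set φ : SchwartzMap (Rd d) ℂ := 𝓕 (hc'.toSchwartzMap hc) with hφ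
  have hφc : (φ : Rd d → ℂ) = 𝓕 c := SchwartzMap.fourier_coe _
  obtain ⟨S, hS, hS'⟩ := exists_tsum_enorm_le φ
  have hint : Integrable (𝓕 c) := hφc ▸ φ.integrable
  refine ⟨∫⁻ x, ‖𝓕 c x‖ₑ, S, hint.2.ne, hS, fun Q hQ => ⟨?_, fun t => ?_⟩⟩
  · have hQ' : (Q : ℝ) ≠ 0 := by exact_mod_cast hQ
    have h1 : Integrable fun x => 𝓕 (dilate Q c) x := by
      simp only [fourier_dilate c Q hQ]
      exact (hint.comp_smul (inv_ne_zero hQ')).const_mul _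
    rw [← ofReal_integral_norm_eq_lintegral_enorm h1,
      ← ofReal_integral_norm_eq_lintegral_enorm hint]
    refine ENNReal.ofReal_le_ofReal (le_of_eq ?_)
    simp only [fourier_dilate c Q hQ, norm_mul]
    rw [integral_const_mul, Measure.integral_comp_smul volume (fun x => ‖𝓕 c x‖),
      finrank_euclideanSpace_fin]
    simp only [norm_inv, norm_pow, RCLike.norm_natCast, inv_pow, inv_inv, smul_eq_mul, abs_pow,
      Nat.abs_cast]
    field_simp
  · have hQ' : (Q : ℝ) ≠ 0 := by exact_mod_cast hQ
    refine le_trans (le_of_eq ?_) (mul_le_mul_right (hS' ((Q : ℝ)⁻¹ • t)) _)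
    rw [← ENNReal.tsum_mul_left]
    congr 1
    ext n
    rw [fourier_dilate c Q hQ, hφc, enorm_mul]
    congr 1
    · rw [enorm_inv (by positivity), enorm_pow]
      congr 2
      rw [← ofReal_norm]; simp
    · refine congrArg (fun z => ‖𝓕 c z‖ₑ) ?_
      ext i
      simp [latticePt, hQ', mul_sub]

/-- The cutoff which equals `1` on the ball of radius `1/8` and lives in that of radius `1/4`. -/
def innerCut (d : ℕ) : Rd d → ℂ := fun ξ =>
  ((⟨1 / 8, 1 / 4, by norm_num, by norm_num⟩ : ContDiffBump (0 : Rd d)) ξ : ℂ)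

/-- The cutoff which equals `1` on the ball of radius `1/4` and lives in that of radius `1/2`. -/
def outerCut (d : ℕ) : Rd d → ℂ := fun ξ =>
  ((⟨1 / 4, 1 / 2, by norm_num, by norm_num⟩ : ContDiffBump (0 : Rd d)) ξ : ℂ)

theorem contDiff_innerCut : ContDiff ℝ ∞ (innerCut d) :=
  Complex.ofRealCLM.contDiff.comp (ContDiffBump.contDiff _)

theorem contDiff_outerCut : ContDiff ℝ ∞ (outerCut d) :=
  Complex.ofRealCLM.contDiff.comp (ContDiffBump.contDiff _)

theorem hasCompactSupport_innerCut : HasCompactSupport (innerCut d) :=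
  (ContDiffBump.hasCompactSupport _).comp_left (g := Complex.ofReal) rfl

theorem hasCompactSupport_outerCut : HasCompactSupport (outerCut d) :=
  (ContDiffBump.hasCompactSupport _).comp_left (g := Complex.ofReal) rfl

theorem innerCut_eq_one {ξ : Rd d} (h : ‖ξ‖ ≤ 1 / 8) : innerCut d ξ = 1 := by
  rw [innerCut, ContDiffBump.one_of_mem_closedBall _ (by simpa using h)]; rfl

theorem innerCut_eq_zero {ξ : Rd d} (h : 1 / 4 ≤ ‖ξ‖) : innerCut d ξ = 0 := by
  rw [innerCut, ContDiffBump.zero_of_le_dist _ (by simpa using h)]; rfl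

theorem outerCut_eq_one {ξ : Rd d} (h : ‖ξ‖ ≤ 1 / 4) : outerCut d ξ = 1 := by
  rw [outerCut, ContDiffBump.one_of_mem_closedBall _ (by simpa using h)]; rfl

/-- Sampling of the band-limited function `𝓕(Θb)` on the lattice `Qℤ^d`. -/
theorem exists_sampling (d : ℕ) {p : ℝ} (hp : 1 < p) :
    ∃ C : ℝ≥0∞, C ≠ ⊤ ∧ ∀ (Θ : Rd d → ℂ) (A : ℝ), MultiplierBound Θ p A → ∀ Q : ℕ, Q ≠ 0 →
      ∀ b : Rd d → ℂ, ContDiff ℝ ∞ b → HasCompactSupport b →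
        (∀ ξ, b ξ ≠ 0 → ‖(Q : ℝ) • ξ‖ ≤ 1 / 4) →
        ∑' n : Zd d, ‖𝓕 (fun ξ => Θ ξ * b ξ) (latticePt ((Q : ℤ) • n))‖ₑ ^ p ≤
          C * ((Q : ℝ≥0∞) ^ d)⁻¹ * ENNReal.ofReal A ^ p * ∫⁻ x, ‖𝓕 b x‖ₑ ^ p := by
  obtain ⟨I, S, hI, hS, hIS⟩ := exists_kernel_bounds (contDiff_outerCut (d := d))
    hasCompactSupport_outerCut
  have hp0 : 0 < p := by linarith
  have hpt : ENNReal.ofReal p ≠ ⊤ := ENNReal.ofReal_ne_top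
  have hpz : ENNReal.ofReal p ≠ 0 := by simpa using hp0
  refine ⟨I ^ (p - 1) * S, ENNReal.mul_ne_top (ENNReal.rpow_ne_top_of_nonneg (by linarith) hI) hS,
    fun Θ A hΘ Q hQ b hb hb' hsupp => ?_⟩
  obtain ⟨g, hg, hgn⟩ := hΘ.exists_Lp hb hb'
  set c := dilate Q (outerCut d) with hcdef
  have hc : ContDiff ℝ ∞ c := contDiff_dilate contDiff_outerCut Q
  have hc' : HasCompactSupport c := hasCompactSupport_dilate hasCompactSupport_outerCut hQ
  have hcb : ∀ ξ, c ξ * b ξ = b ξ := by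
    intro ξ
    by_cases h : b ξ = 0
    · simp [h]
    · rw [hcdef, dilate, outerCut_eq_one (hsupp ξ h), one_mul]
  have hcont : Continuous (𝓕 c) := by
    have := (𝓕 (hc'.toSchwartzMap hc) : SchwartzMap (Rd d) ℂ).continuous
    rwa [SchwartzMap.fourier_coe] at this
  have hgm : AEMeasurable (fun y => ‖g y‖ₑ) (volume : Measure (Rd d)) :=
    (Lp.aestronglyMeasurable g).enorm
  -- Schur test from `ℝ^d` to `ℤ^d`: the integral over `y` is at most `I`, and the sum over `n`
  -- supplies the gain `Q^{-d}`.
  have hschur := schur_test (μ := (Measure.count : Measure (Zd d))) (ν := (volume : Measure (Rd d)))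
    hp (k := fun n y => ‖𝓕 c (latticePt ((Q : ℤ) • n) - y)‖ₑ) (g := fun y => ‖g y‖ₑ)
    (a := I) (b := ((Q : ℝ≥0∞) ^ d)⁻¹ * S) ?_ hgm ?_ ?_
  · have hfin : ∫⁻ y, ‖g y‖ₑ ^ p ≤ ENNReal.ofReal A ^ p * ∫⁻ x, ‖𝓕 b x‖ₑ ^ p := by
      rw [eLpNorm_eq_lintegral_rpow_enorm_toReal hpz hpt,
        eLpNorm_eq_lintegral_rpow_enorm_toReal hpz hpt, ENNReal.toReal_ofReal hp0.le] at hgn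
      have := ENNReal.rpow_le_rpow hgn hp0.le
      rwa [ENNReal.mul_rpow_of_nonneg _ _ hp0.le, ← ENNReal.rpow_mul, ← ENNReal.rpow_mul, one_div,
        inv_mul_cancel₀ hp0.ne', ENNReal.rpow_one, ENNReal.rpow_one] at this
    rw [lintegral_count] at hschur
    calc _ ≤ ∑' n : Zd d, (∫⁻ y, ‖𝓕 c (latticePt ((Q : ℤ) • n) - y)‖ₑ * ‖g y‖ₑ) ^ p := by
          refine ENNReal.tsum_le_tsum fun n => ?_
          gcongr
          rw [fourier_mul_eq_convolution hg hc hc' hcb]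
          refine (enorm_integral_le_lintegral_enorm _).trans (le_of_eq ?_)
          simp only [enorm_mul, mul_comm]
      _ ≤ _ := hschur
      _ ≤ I ^ (p - 1) * (((Q : ℝ≥0∞) ^ d)⁻¹ * S) *
          (ENNReal.ofReal A ^ p * ∫⁻ x, ‖𝓕 b x‖ₑ ^ p) := by gcongr
      _ = _ := by ring
  · refine measurable_from_prod_countable_right fun n => ?_
    have : Continuous fun y => 𝓕 c (latticePt ((Q : ℤ) • n) - y) :=
      hcont.comp (continuous_const.sub continuous_id)
    exact this.enorm.measurable
  · intro n
    rw [lintegral_sub_left_eq_self (fun y => ‖𝓕 c y‖ₑ)]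
    exact (hIS Q hQ).1
  · intro y
    rw [lintegral_count]
    exact (hIS Q hQ).2 y

/-- The trigonometric polynomial with coefficients `h`, times a cutoff. -/
theorem fourier_mul_trigPoly {c : Rd d → ℂ} (hc : Integrable c) (S : Finset (Zd d)) (h : Zd d → ℂ)
    (Q : ℕ) (x : Rd d) :
    𝓕 (fun ξ => c ξ * ∑ m ∈ S, h m * Complex.exp (((2 * Real.pi *
      inner ℝ ξ (latticePt ((Q : ℤ) • m)) : ℝ) : ℂ) * Complex.I)) x =
    ∑ m ∈ S, h m * 𝓕 c (x - latticePt ((Q : ℤ) • m)) := by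
  simp only [Real.fourier_eq', Finset.mul_sum, smul_eq_mul, ← integral_const_mul]
  rw [← integral_finsetSum]
  · refine integral_congr_ae (.of_forall fun ξ => ?_)
    refine Finset.sum_congr rfl fun m _ => ?_
    rw [inner_sub_right, mul_sub, sub_eq_add_neg, Complex.ofReal_add, add_mul, Complex.exp_add,
      show ((-(-2 * Real.pi * inner ℝ ξ (latticePt ((Q : ℤ) • m))) : ℝ) : ℂ) =
        ((2 * Real.pi * inner ℝ ξ (latticePt ((Q : ℤ) • m)) : ℝ) : ℂ) by congr 1; ring]
    ring
  · intro m _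
    refine Integrable.const_mul ?_ _
    refine hc.bdd_mul (c := 1) ?_ (.of_forall fun ξ => ?_)
    · exact Continuous.aestronglyMeasurable (by fun_prop)
    · rw [Complex.norm_exp_ofReal_mul_I]

theorem contDiff_trigPoly (S : Finset (Zd d)) (h : Zd d → ℂ) (Q : ℕ) :
    ContDiff ℝ ∞ fun ξ : Rd d => ∑ m ∈ S, h m * Complex.exp (((2 * Real.pi *
      inner ℝ ξ (latticePt ((Q : ℤ) • m)) : ℝ) : ℂ) * Complex.I) := by
  refine ContDiff.sum fun m _ => contDiff_const.mul (ContDiff.cexp (ContDiff.mul ?_ contDiff_const))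
  exact Complex.ofRealCLM.contDiff.comp (contDiff_const.mul (contDiff_id.inner ℝ contDiff_const))

/-- `∑_{m} h(m) ψ_Q(x - Qm)` in `L^p`. -/
theorem exists_synthesis (d : ℕ) {p : ℝ} (hp : 1 < p) :
    ∃ C : ℝ≥0∞, C ≠ ⊤ ∧ ∀ Q : ℕ, Q ≠ 0 → ∀ (S : Finset (Zd d)) (h : Zd d → ℂ),
      ∫⁻ x, ‖∑ m ∈ S, h m * 𝓕 (dilate Q (innerCut d)) (x - latticePt ((Q : ℤ) • m))‖ₑ ^ p ≤
        C * ((Q : ℝ≥0∞) ^ d)⁻¹ ^ (p - 1) * ∑ m ∈ S, ‖h m‖ₑ ^ p := by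
  obtain ⟨I, K, hI, hK, hIK⟩ := exists_kernel_bounds (contDiff_innerCut (d := d))
    hasCompactSupport_innerCut
  refine ⟨K ^ (p - 1) * I, ENNReal.mul_ne_top (ENNReal.rpow_ne_top_of_nonneg (by linarith) hK) hI,
    fun Q hQ S h => ?_⟩
  set c := dilate Q (innerCut d) with hcdef
  have hc : ContDiff ℝ ∞ c := contDiff_dilate contDiff_innerCut Q
  have hc' : HasCompactSupport c := hasCompactSupport_dilate hasCompactSupport_innerCut hQ
  have hcont : Continuous (𝓕 c) := by
    have := (𝓕 (hc'.toSchwartzMap hc) : SchwartzMap (Rd d) ℂ).continuous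
    rwa [SchwartzMap.fourier_coe] at this
  have hzero : (0 : ℝ≥0∞) ^ p = 0 := ENNReal.zero_rpow_of_pos (by linarith)
  classical
  -- The roles are now reversed: the sum over `m` carries `Q^{-d}` and enters with the power `p -
  -- 1`.
  have hschur := schur_test (ν := (Measure.count : Measure (Zd d))) (μ := (volume : Measure (Rd d)))
    hp (k := fun x m => ‖𝓕 c (x - latticePt ((Q : ℤ) • m))‖ₑ)
    (g := fun m => if m ∈ S then ‖h m‖ₑ else 0)
    (a := ((Q : ℝ≥0∞) ^ d)⁻¹ * K) (b := I) ?_ (measurable_of_countable _).aemeasurable ?_ ?_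
  · simp only [lintegral_count] at hschur
    rw [tsum_eq_sum (s := S) (fun m hm => by simp [hm, hzero])] at hschur
    calc _ ≤ ∫⁻ x, (∑' m : Zd d, ‖𝓕 c (x - latticePt ((Q : ℤ) • m))‖ₑ *
            if m ∈ S then ‖h m‖ₑ else 0) ^ p := by
          gcongr with x
          rw [tsum_eq_sum (s := S) (fun m hm => by simp [hm])]
          refine (enorm_sum_le _ _).trans (Finset.sum_le_sum fun m hm => ?_)
          rw [enorm_mul, mul_comm, if_pos hm]
      _ ≤ _ := hschur
      _ = _ := by
          rw [ENNReal.mul_rpow_of_nonneg _ _ (by linarith),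
            Finset.sum_congr rfl (g := fun m => ‖h m‖ₑ ^ p) fun m hm => by rw [if_pos hm]]
          ring
  · refine measurable_from_prod_countable_left fun n => ?_
    have : Continuous fun x => 𝓕 c (x - latticePt ((Q : ℤ) • n)) :=
      hcont.comp (continuous_id.sub continuous_const)
    exact this.enorm.measurable
  · intro x
    rw [lintegral_count, ← (Equiv.neg (Zd d)).tsum_eq]
    refine le_trans (le_of_eq ?_) ((hIK Q hQ).2 (-x))
    congr 1; ext m
    refine congrArg (fun z => ‖𝓕 c z‖ₑ) ?_
    ext i; simp [latticePt]; ring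
  · intro m
    rw [lintegral_sub_right_eq_self (fun y => ‖𝓕 c y‖ₑ)]
    exact (hIK Q hQ).1

/-- The transference principle: `Θ(·/Q)`, localized near the origin, is a multiplier on `ℤ^d`. -/
theorem exists_transference (d : ℕ) {p : ℝ} (hp : 1 < p) :
    ∃ C : ℝ≥0∞, C ≠ ⊤ ∧ ∀ (Θ : Rd d → ℂ) (A : ℝ), MultiplierBound Θ p A → ∀ Q : ℕ, Q ≠ 0 →
      ∀ (S : Finset (Zd d)) (h : Zd d → ℂ),
        ∑' n : Zd d, ‖∑ m ∈ S, (Q : ℂ) ^ d *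
          𝓕 (fun ξ => Θ ξ * dilate Q (innerCut d) ξ) (latticePt ((Q : ℤ) • (n - m))) * h m‖ₑ ^ p ≤
        C * ENNReal.ofReal A ^ p * ∑ m ∈ S, ‖h m‖ₑ ^ p := by
  obtain ⟨C₁, hC₁, h₁⟩ := exists_sampling d hp
  obtain ⟨C₂, hC₂, h₂⟩ := exists_synthesis d hp
  refine ⟨C₁ * C₂, ENNReal.mul_ne_top hC₁ hC₂, fun Θ A hΘ Q hQ S h => ?_⟩
  set c := dilate Q (innerCut d) with hcdef
  have hc : ContDiff ℝ ∞ c := contDiff_dilate contDiff_innerCut Q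
  have hc' : HasCompactSupport c := hasCompactSupport_dilate hasCompactSupport_innerCut hQ
  have hQd : (Q : ℝ≥0∞) ^ d ≠ 0 := by positivity
  have hQt : (Q : ℝ≥0∞) ^ d ≠ ⊤ := by finiteness
  set P : Rd d → ℂ := fun ξ => ∑ m ∈ S, h m * Complex.exp (((2 * Real.pi *
      inner ℝ ξ (latticePt ((Q : ℤ) • m)) : ℝ) : ℂ) * Complex.I) with hP
  -- With `b = cP`, the transform of `b` is the synthesis of `h`, and the samples of `𝓕(Θb)` on
  -- `Qℤ^d` are the discrete convolution to be bounded.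
  have hs := h₁ Θ A hΘ Q hQ (fun ξ => c ξ * P ξ) (hc.mul (contDiff_trigPoly S h Q))
    hc'.mul_right (fun ξ hξ => ?_)
  · have e1 : ∀ x, 𝓕 (fun ξ => Θ ξ * (c ξ * P ξ)) x =
        ∑ m ∈ S, h m * 𝓕 (fun ξ => Θ ξ * c ξ) (x - latticePt ((Q : ℤ) • m)) := by
      intro x
      rw [← fourier_mul_trigPoly (hΘ.integrable hc hc') S h Q x]
      simp only [mul_assoc, hP]
    have e2 : ∀ x, 𝓕 (fun ξ => c ξ * P ξ) x =
        ∑ m ∈ S, h m * 𝓕 c (x - latticePt ((Q : ℤ) • m)) := by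
      intro x
      rw [← fourier_mul_trigPoly (hc.continuous.integrable_of_hasCompactSupport hc') S h Q x]
    simp only [e1, e2] at hs
    have hsyn := h₂ Q hQ S h
    calc _ = ((Q : ℝ≥0∞) ^ d) ^ p * ∑' n : Zd d, ‖∑ m ∈ S, h m * 𝓕 (fun ξ => Θ ξ * c ξ)
            (latticePt ((Q : ℤ) • n) - latticePt ((Q : ℤ) • m))‖ₑ ^ p := by
          rw [← ENNReal.tsum_mul_left]
          congr 1; ext n
          rw [← ENNReal.mul_rpow_of_nonneg _ _ (by linarith)]
          have : ((Q : ℝ≥0∞) ^ d) = ‖(Q : ℂ) ^ d‖ₑ := by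
            rw [← ofReal_norm]; simp
          rw [this, ← enorm_mul, Finset.mul_sum]
          congr 2
          refine Finset.sum_congr rfl fun m _ => ?_
          rw [smul_sub, latticePt_sub]; ring
      _ ≤ ((Q : ℝ≥0∞) ^ d) ^ p * (C₁ * ((Q : ℝ≥0∞) ^ d)⁻¹ * ENNReal.ofReal A ^ p *
            (C₂ * ((Q : ℝ≥0∞) ^ d)⁻¹ ^ (p - 1) * ∑ m ∈ S, ‖h m‖ₑ ^ p)) := by
          gcongr
          exact hs.trans (by gcongr)
      -- The exponents of `Q^d` are `p` from the normalization, `-1` from sampling and `-(p - 1)`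
      -- from synthesis; they add up to zero.
      _ = (((Q : ℝ≥0∞) ^ d) ^ p * (((Q : ℝ≥0∞) ^ d)⁻¹ * ((Q : ℝ≥0∞) ^ d)⁻¹ ^ (p - 1))) *
            (C₁ * C₂ * ENNReal.ofReal A ^ p * ∑ m ∈ S, ‖h m‖ₑ ^ p) := by ring
      _ = _ := by
          have : ((Q : ℝ≥0∞) ^ d)⁻¹ * ((Q : ℝ≥0∞) ^ d)⁻¹ ^ (p - 1) = ((Q : ℝ≥0∞) ^ d)⁻¹ ^ p := by
            conv_lhs => lhs; rw [← ENNReal.rpow_one (((Q : ℝ≥0∞) ^ d)⁻¹)]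
            rw [← ENNReal.rpow_add_of_nonneg _ _ zero_le_one (by linarith)]
            congr 1; ring
          rw [this, ← ENNReal.mul_rpow_of_nonneg _ _ (by linarith),
            ENNReal.mul_inv_cancel hQd hQt, ENNReal.one_rpow, one_mul]
  · by_contra hlt
    apply hξ
    rw [hcdef, dilate, innerCut_eq_zero (not_le.1 hlt).le, zero_mul]

end Transference

/-! ### Functions on the torus -/

section Torus

variable {d : ℕ}

/-- The normalized Haar measure on `𝕋^d`. -/
abbrev torusMeasure (d : ℕ) : Measure (Td d) := Measure.pi fun _ : Fin d => AddCircle.haarAddCircle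

theorem mFourierCoeff_eq (g : Td d → ℂ) (n : Zd d) :
    UnitAddTorus.mFourierCoeff g n = ∫ t, UnitAddTorus.mFourier (-n) t * g t ∂torusMeasure d := rfl

theorem norm_mFourier_apply (n : Zd d) (t : Td d) : ‖UnitAddTorus.mFourier n t‖ = 1 := by
  simp [UnitAddTorus.mFourier, norm_prod, Circle.norm_coe]

theorem mFourier_add_apply (n : Zd d) (s t : Td d) :
    UnitAddTorus.mFourier n (s + t) = UnitAddTorus.mFourier n s * UnitAddTorus.mFourier n t := by
  simp [UnitAddTorus.mFourier, AddCircle.toCircle_add, Finset.prod_mul_distrib]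

theorem torusRep_coe (t : Td d) (i : Fin d) : ((torusRep t i : ℝ) : UnitAddCircle) = t i :=
  (AddCircle.equivIco (1 : ℝ) (-1 / 2)).symm_apply_apply (t i)

theorem torusRep_mem (t : Td d) (i : Fin d) : torusRep t i ∈ Set.Ico (-1 / 2 : ℝ) (1 / 2) := by
  have h : torusRep t i ∈ Set.Ico (-1 / 2 : ℝ) (-1 / 2 + 1) :=
    (AddCircle.equivIco (1 : ℝ) (-1 / 2) (t i)).2
  exact ⟨h.1, h.2.trans_eq (by norm_num)⟩

theorem abs_torusRep (t : Td d) (i : Fin d) : |torusRep t i| = ‖t i‖ := by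
  rw [← torusRep_coe t i, eq_comm, AddCircle.norm_coe_eq_abs_iff _ one_ne_zero, abs_one, abs_le]
  have := torusRep_mem t i
  constructor <;> linarith [this.1, this.2]

theorem torusRep_of_mem {x : Fin d → ℝ} {i : Fin d} (hx : x i ∈ Set.Ico (-1 / 2 : ℝ) (1 / 2)) :
    torusRep (fun i => (x i : UnitAddCircle) : Td d) i = x i := by
  have hx' : x i ∈ Set.Ico (-1 / 2 : ℝ) (-1 / 2 + 1) := by norm_num at hx ⊢; exact hx
  exact congrArg Subtype.val
    ((AddCircle.equivIco (1 : ℝ) (-1 / 2)).apply_symm_apply ⟨x i, hx'⟩)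

theorem norm_apply_le_norm (x : Rd d) (i : Fin d) : |x i| ≤ ‖x‖ := by
  simpa using PiLp.norm_apply_le x i

/-- `torusRep` takes values in `[-1/2, 1/2)`, while torus integrals are computed over `(-1/2, 1/2]`.
The two conventions differ only on faces of the cube, where `g` vanishes. -/
theorem onTorus_coe {g : Rd d → ℂ} (hg : ∀ ξ, 1 / 2 ≤ ‖ξ‖ → g ξ = 0) {x : Fin d → ℝ}
    (hx : ∀ i, x i ∈ Set.Ioc (-1 / 2 : ℝ) (1 / 2)) :
    onTorus g (fun i => (x i : UnitAddCircle)) = g (WithLp.toLp 2 x) := by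
  by_cases h : ∀ i, x i < 1 / 2
  · rw [onTorus]
    congr 1
    ext i
    exact torusRep_of_mem ⟨(hx i).1.le, h i⟩
  · push Not at h
    obtain ⟨i, hi⟩ := h
    have hxi : x i = 1 / 2 := le_antisymm (hx i).2 hi
    rw [onTorus, hg, hg]
    · refine le_trans ?_ (norm_apply_le_norm _ i)
      simp [hxi]
    · refine le_trans ?_ (norm_apply_le_norm _ i)
      rw [abs_torusRep, (AddCircle.norm_coe_eq_abs_iff _ one_ne_zero).2] <;> simp [hxi]

/-- The support of `g` fits in one period cell, so the integral over the cell is the integral over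
`ℝ^d`. -/
theorem mFourierCoeff_onTorus {g : Rd d → ℂ} (hg : ∀ ξ, 1 / 2 ≤ ‖ξ‖ → g ξ = 0) (n : Zd d) :
    UnitAddTorus.mFourierCoeff (onTorus g) n = 𝓕 g (latticePt n) := by
  rw [UnitAddTorus.mFourierCoeff_eq_integral _ _ (fun _ => (-1 / 2 : ℝ)), Real.fourier_eq',
    ← (PiLp.volume_preserving_toLp (Fin d)).integral_comp
      (MeasurableEquiv.toLp 2 (Fin d → ℝ)).measurableEmbedding]
  have hms : MeasurableSet {x : Fin d → ℝ | ∀ i, x i ∈ Set.Ioc (-1 / 2 : ℝ) (-1 / 2 + 1)} :=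
    MeasurableSet.univ_pi' fun i => measurableSet_Ioc
  rw [← integral_indicator hms]
  congr 1
  ext x
  rw [Set.indicator_apply]
  split_ifs with hx
  · rw [onTorus_coe hg (by norm_num at hx ⊢; exact hx)]
    congr 1
    simp only [UnitAddTorus.mFourier, ContinuousMap.coe_mk, Pi.neg_apply, fourier_coe_apply,
      ← Complex.exp_sum]
    congr 1
    simp only [latticePt, PiLp.inner_apply, RCLike.inner_apply, Complex.ofReal_mul,
      Complex.ofReal_sum, Finset.mul_sum, Finset.sum_mul]
    refine Finset.sum_congr rfl fun i _ => ?_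
    push_cast
    simp
    ring
  · rw [hg, smul_zero]
    simp only [Set.mem_ofPred_eq, not_forall] at hx
    obtain ⟨i, hi⟩ := hx
    refine le_trans ?_ (norm_apply_le_norm _ i)
    by_contra hlt
    apply hi
    have := abs_lt.1 (not_le.1 hlt)
    simp only at this
    constructor <;> linarith [this.1, this.2]

theorem integrable_onTorus {g : Rd d → ℂ} (hg : ∀ ξ, 1 / 2 ≤ ‖ξ‖ → g ξ = 0) (hi : Integrable g) :
    Integrable (onTorus g) (torusMeasure d) := by
  have hmp : MeasurePreserving (UnitAddTorus.measurableEquivPiIoc fun _ : Fin d => (-1 / 2 : ℝ))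
      (torusMeasure d) (Measure.comap Subtype.val volume) :=
    UnitAddTorus.measurePreserving_equivPiIoc _
  have hms : MeasurableSet {x : Fin d → ℝ | ∀ i, x i ∈ Set.Ioc (-1 / 2 : ℝ) (-1 / 2 + 1)} :=
    MeasurableSet.univ_pi' fun i => measurableSet_Ioc
  have h1 : Integrable (fun x : Fin d → ℝ => g (WithLp.toLp 2 x)) :=
    ((PiLp.volume_preserving_toLp (Fin d)).integrable_comp_emb
      (MeasurableEquiv.toLp 2 (Fin d → ℝ)).measurableEmbedding).2 hi
  have h2 : Integrable (fun x : {x : Fin d → ℝ // ∀ i, x i ∈ Set.Ioc (-1 / 2 : ℝ) (-1 / 2 + 1)} =>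
      g (WithLp.toLp 2 x.1)) (Measure.comap Subtype.val volume) := by
    have := (MeasurableEmbedding.subtype_coe hms).integrable_map_iff
      (μ := Measure.comap Subtype.val volume) (g := fun x : Fin d → ℝ => g (WithLp.toLp 2 x))
    refine this.1 ?_
    rw [map_comap_subtype_coe hms]
    exact h1.restrict
  refine (hmp.integrable_comp_of_integrable h2).congr (.of_forall fun t => ?_)
  have h3 := (UnitAddTorus.measurableEquivPiIoc fun _ : Fin d => (-1 / 2 : ℝ)).symm_apply_apply t
  conv_rhs => rw [← h3]
  rw [UnitAddTorus.coe_symm_measurableEquivPiIoc_apply, onTorus_coe hg]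
  · rfl
  · intro i
    have := ((UnitAddTorus.measurableEquivPiIoc fun _ : Fin d => (-1 / 2 : ℝ)) t).2 i
    norm_num at this ⊢; exact this

theorem integrable_comp_sub {m : Td d → ℂ} (hm : Integrable m (torusMeasure d)) (a : Td d) :
    Integrable (fun t => m (t - a)) (torusMeasure d) := hm.comp_sub_right a

theorem mFourierCoeff_comp_sub (m : Td d → ℂ) (a : Td d) (n : Zd d) :
    UnitAddTorus.mFourierCoeff (fun t => m (t - a)) n =
      UnitAddTorus.mFourier (-n) a * UnitAddTorus.mFourierCoeff m n := by
  rw [mFourierCoeff_eq, mFourierCoeff_eq, ← integral_const_mul,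
    ← integral_add_right_eq_self (μ := torusMeasure d) _ a]
  congr 1
  ext t
  rw [add_sub_cancel_right, mFourier_add_apply]
  ring

theorem integrable_mFourier_mul {m : Td d → ℂ} (hm : Integrable m (torusMeasure d)) (n : Zd d) :
    Integrable (fun t => UnitAddTorus.mFourier n t * m t) (torusMeasure d) := by
  refine hm.bdd_mul (c := 1) ?_ (Filter.Eventually.of_forall fun t => (norm_mFourier_apply n t).le)
  exact (UnitAddTorus.mFourier n).continuous.aestronglyMeasurable

theorem mFourierCoeff_sum {ι : Type*} (s : Finset ι) {m : ι → Td d → ℂ}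
    (hm : ∀ i ∈ s, Integrable (m i) (torusMeasure d)) (n : Zd d) :
    UnitAddTorus.mFourierCoeff (fun t => ∑ i ∈ s, m i t) n =
      ∑ i ∈ s, UnitAddTorus.mFourierCoeff (m i) n := by
  simp only [mFourierCoeff_eq, Finset.mul_sum]
  exact integral_finsetSum _ fun i hi => integrable_mFourier_mul (hm i hi) _

theorem mFourierCoeff_const_mul (c : ℂ) (m : Td d → ℂ) (n : Zd d) :
    UnitAddTorus.mFourierCoeff (fun t => c * m t) n = c * UnitAddTorus.mFourierCoeff m n := by
  simp only [mFourierCoeff_eq, ← integral_const_mul]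
  congr 1; ext t; ring

theorem sum_fourier_div (Q : ℕ) (hQ : Q ≠ 0) (n : ℤ) :
    ∑ a ∈ Finset.Icc 1 Q, fourier n ((((a : ℝ) / (Q : ℝ) : ℝ)) : UnitAddCircle) =
      if (Q : ℤ) ∣ n then (Q : ℂ) else 0 := by
  have hQ' : (Q : ℂ) ≠ 0 := by exact_mod_cast hQ
  set z : ℂ := Complex.exp (2 * Real.pi * Complex.I * n / Q) with hz
  have h1 : ∀ a : ℕ, fourier n ((((a : ℝ) / (Q : ℝ) : ℝ)) : UnitAddCircle) = z ^ a := by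
    intro a
    rw [fourier_coe_apply, hz, ← Complex.exp_nat_mul]
    congr 1; push_cast; field_simp
  have hzQ : z ^ Q = 1 := by
    rw [hz, ← Complex.exp_nat_mul, Complex.exp_eq_one_iff]
    exact ⟨n, by field_simp⟩
  have hz1 : z = 1 ↔ (Q : ℤ) ∣ n := by
    rw [hz, Complex.exp_eq_one_iff]
    have h2pi : (2 * Real.pi * Complex.I : ℂ) ≠ 0 := Complex.two_pi_I_ne_zero
    constructor
    · rintro ⟨m, hm⟩
      refine ⟨m, ?_⟩
      rw [mul_div_assoc, mul_comm (m : ℂ)] at hm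
      have := mul_left_cancel₀ h2pi hm
      rw [div_eq_iff hQ'] at this
      exact_mod_cast this.trans (mul_comm _ _)
    · rintro ⟨m, rfl⟩
      exact ⟨m, by push_cast; field_simp⟩
  simp only [h1]
  split_ifs with h
  · simp [hz1.2 h]
  · have hne : z - 1 ≠ 0 := sub_ne_zero.2 fun e => h (hz1.1 e)
    have hg := geom_sum_mul z Q
    rw [hzQ, sub_self, mul_eq_zero, or_iff_left hne] at hg
    have : ∑ a ∈ Finset.Icc 1 Q, z ^ a = z * ∑ a ∈ Finset.range Q, z ^ a := by
      rw [Finset.mul_sum, ← Finset.Ico_add_one_right_eq_Icc, Finset.sum_Ico_eq_sum_range]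
      exact Finset.sum_congr rfl fun a _ => by rw [pow_add, pow_one]
    rw [this, hg, mul_zero]

theorem sum_mFourier_ratPt (Q : ℕ) (hQ : Q ≠ 0) (n : Zd d) :
    ∑ b ∈ box d Q, UnitAddTorus.mFourier n (ratPt Q b) =
      if ∀ i, (Q : ℤ) ∣ n i then (Q : ℂ) ^ d else 0 := by
  simp only [UnitAddTorus.mFourier, ContinuousMap.coe_mk, ratPt, box]
  rw [Finset.sum_prod_piFinset (Finset.Icc 1 Q)
    (fun i a => fourier (n i) ((((a : ℝ) / (Q : ℝ) : ℝ)) : UnitAddCircle))]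
  simp only [sum_fourier_div Q hQ]
  split_ifs with h
  · simp [h]
  · push Not at h
    obtain ⟨i, hi⟩ := h
    exact Finset.prod_eq_zero (Finset.mem_univ i) (by simp [hi])

theorem integrable_shiftSum {g : Rd d → ℂ} (hg : ∀ ξ, 1 / 2 ≤ ‖ξ‖ → g ξ = 0) (hi : Integrable g)
    (Q : ℕ) (u : Td d) : Integrable (shiftSum Q g u) (torusMeasure d) := by
  refine integrable_finsetSum _ fun b _ => ?_
  simp only [sub_sub]
  exact integrable_comp_sub (integrable_onTorus hg hi) _

/-- Each translation multiplies the coefficient by a character, and summing the characters over all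
`b/Q` annihilates every `n` outside `Qℤ^d`. This is what decouples the residue classes mod `Q`. -/
theorem mFourierCoeff_shiftSum {g : Rd d → ℂ} (hg : ∀ ξ, 1 / 2 ≤ ‖ξ‖ → g ξ = 0)
    (hi : Integrable g) {Q : ℕ} (hQ : Q ≠ 0) (u : Td d) (n : Zd d) :
    UnitAddTorus.mFourierCoeff (shiftSum Q g u) n =
      UnitAddTorus.mFourier (-n) u * (if ∀ i, (Q : ℤ) ∣ n i then (Q : ℂ) ^ d else 0) *
        𝓕 g (latticePt n) := by
  have h := integrable_onTorus hg hi
  have hs : shiftSum Q g u = fun ξ => ∑ b ∈ box d Q, onTorus g (ξ - (ratPt Q b + u)) := by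
    ext ξ; simp only [shiftSum, sub_sub]
  rw [hs, mFourierCoeff_sum _ fun b _ => integrable_comp_sub h _]
  simp only [mFourierCoeff_comp_sub (onTorus g), mFourier_add_apply, mFourierCoeff_onTorus hg]
  rw [← Finset.sum_mul, ← Finset.sum_mul, sum_mFourier_ratPt Q hQ]
  simp only [Pi.neg_apply, dvd_neg]
  ring

/-- `torusRep` is discontinuous only at the faces `-1/2`. If some `‖t i‖ > 1/4`, the function
vanishes near `t`; otherwise `t` stays away from those faces. -/
theorem continuous_onTorus {g : Rd d → ℂ} (hc : Continuous g) (hg : ∀ ξ, 1 / 4 ≤ ‖ξ‖ → g ξ = 0) :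
    Continuous (onTorus g) := by
  rw [continuous_iff_continuousAt]
  intro t
  by_cases h : ∃ i, 1 / 4 < ‖t i‖
  · obtain ⟨i, hi⟩ := h
    have hev : ∀ᶠ s : Td d in nhds t, onTorus g s = 0 := by
      have : ContinuousAt (fun s : Td d => ‖s i‖) t := (continuous_apply i).norm.continuousAt
      filter_upwards [this.eventually_const_lt hi] with s hs
      rw [onTorus, hg]
      exact (hs.le.trans_eq (abs_torusRep s i).symm).trans (norm_apply_le_norm _ i)
    exact (continuousAt_const (y := (0 : ℂ))).congr (hev.mono fun s hs => hs.symm)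
  · push Not at h
    have hrep : ContinuousAt (torusRep : Td d → Rd d) t := by
      refine (PiLp.continuous_toLp 2 _).continuousAt.comp ?_
      rw [continuousAt_pi]
      intro i
      have hne : t i ≠ ((-1 / 2 : ℝ) : UnitAddCircle) := by
        intro he
        have := h i
        rw [he, (AddCircle.norm_coe_eq_abs_iff _ one_ne_zero).2 (by norm_num)] at this
        norm_num [abs_of_pos] at this
      exact (continuousAt_subtype_val.comp
        (AddCircle.continuousAt_equivIco (1 : ℝ) (-1 / 2) hne)).comp
          (f := fun s : Td d => s i) (continuous_apply i).continuousAt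
    exact hc.continuousAt.comp hrep

theorem continuous_shiftSum {g : Rd d → ℂ} (hc : Continuous g)
    (hg : ∀ ξ, 1 / 4 ≤ ‖ξ‖ → g ξ = 0) (Q : ℕ) (u : Td d) : Continuous (shiftSum Q g u) := by
  have := continuous_onTorus hc hg
  unfold shiftSum
  fun_prop

end Torus

/-! ### Khinchine's inequality and the Marcinkiewicz–Zygmund theorem -/

section Khinchine

variable {ι : Type*} [Fintype ι] [DecidableEq ι]

theorem sum_units_int {M : Type*} [AddCommMonoid M] (f : ℤˣ → M) :
    ∑ e, f e = f 1 + f (-1) := by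
  rw [UnitsInt.univ, Finset.sum_pair (by decide)]

theorem card_signs : (Fintype.card (ι → ℤˣ) : ℝ) = 2 ^ Fintype.card ι := by
  simp [Fintype.card_units_int]

/-- Flipping the `i`-th sign permutes the sign patterns and negates the summand. -/
theorem sum_signs_mul_of_ne {i j : ι} (hij : i ≠ j) :
    ∑ e : ι → ℤˣ, (((e i : ℤ) : ℝ) * ((e j : ℤ) : ℝ)) = 0 := by
  have h := Equiv.sum_comp (Equiv.mulLeft (Pi.mulSingle i (-1) : ι → ℤˣ))
    fun e : ι → ℤˣ => (((e i : ℤ) : ℝ) * ((e j : ℤ) : ℝ))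
  simp only [Equiv.coe_mulLeft, Pi.mul_apply, Pi.mulSingle_eq_same,
    Pi.mulSingle_eq_of_ne hij.symm, one_mul, neg_mul, Units.val_neg, Int.cast_neg,
    Finset.sum_neg_distrib] at h
  linarith

theorem sum_signs_norm_sq (a : ι → ℂ) :
    ∑ e : ι → ℤˣ, ‖∑ i, ((e i : ℤ) : ℂ) * a i‖ ^ 2 = 2 ^ Fintype.card ι * ∑ i, ‖a i‖ ^ 2 := by
  have h1 : ∀ e : ι → ℤˣ, ‖∑ i, ((e i : ℤ) : ℂ) * a i‖ ^ 2 =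
      ∑ i, ∑ j, (((e i : ℤ) : ℝ) * ((e j : ℤ) : ℝ)) * (a i * (starRingEnd ℂ) (a j)).re := by
    intro e
    have : ((‖∑ i, ((e i : ℤ) : ℂ) * a i‖ ^ 2 : ℝ) : ℂ) = ∑ i, ∑ j,
        ((((e i : ℤ) : ℝ) * ((e j : ℤ) : ℝ) : ℝ) : ℂ) * (a i * (starRingEnd ℂ) (a j)) := by
      push_cast
      rw [← Complex.mul_conj', map_sum, Finset.sum_mul_sum]
      refine Finset.sum_congr rfl fun i _ => Finset.sum_congr rfl fun j _ => ?_
      simp only [map_mul, map_intCast]; ring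
    have h2 := congrArg Complex.re this
    rw [Complex.ofReal_re] at h2
    rw [h2]
    simp only [Complex.re_sum, Complex.re_ofReal_mul]
  simp only [h1]
  rw [Finset.sum_comm, Finset.mul_sum]
  refine Finset.sum_congr rfl fun i _ => ?_
  rw [Finset.sum_comm, Finset.sum_eq_single i]
  · rw [← Finset.sum_mul]
    have : ∀ e : ι → ℤˣ, ((e i : ℤ) : ℝ) * ((e i : ℤ) : ℝ) = 1 := by
      intro e
      exact_mod_cast Int.units_coe_mul_self (e i)
    simp only [this, Finset.sum_const, Finset.card_univ, nsmul_eq_mul, mul_one, card_signs]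
    rw [Complex.mul_conj, Complex.normSq_eq_norm_sq, Complex.ofReal_re]
  · intro j _ hj
    rw [← Finset.sum_mul, sum_signs_mul_of_ne hj.symm, zero_mul]
  · simp

/-- The case `r = 1` is an identity, by orthogonality of the signs; the power mean inequality does
the rest. -/
theorem pow_sum_norm_sq_le_sum_signs (a : ι → ℂ) {r : ℕ} (hr : 1 ≤ r) :
    2 ^ Fintype.card ι * (∑ i, ‖a i‖ ^ 2) ^ r ≤
      ∑ e : ι → ℤˣ, ‖∑ i, ((e i : ℤ) : ℂ) * a i‖ ^ (2 * r) := by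
  obtain ⟨s, rfl⟩ := Nat.exists_eq_add_of_le' hr
  have h := pow_sum_div_card_le_sum_pow (s := (Finset.univ : Finset (ι → ℤˣ)))
    (f := fun e => ‖∑ i, ((e i : ℤ) : ℂ) * a i‖ ^ 2) (fun e _ => by positivity) s
  rw [sum_signs_norm_sq, Finset.card_univ, card_signs, mul_pow, pow_succ, mul_assoc, mul_div_assoc,
    mul_div_cancel₀ _ (by positivity)] at h
  simpa only [pow_mul] using h

/-- The average over independent signs factors into `∏ cosh (b i)`, and `cosh x ≤ exp (x² / 2)`. -/
theorem sum_signs_exp (b : ι → ℝ) (hb : ∑ i, b i ^ 2 = 1) :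
    ∑ e : ι → ℤˣ, Real.exp (∑ i, ((e i : ℤ) : ℝ) * b i) ≤
      2 ^ Fintype.card ι * Real.exp (1 / 2) := by
  have h1 : ∑ e : ι → ℤˣ, Real.exp (∑ i, ((e i : ℤ) : ℝ) * b i) =
      ∏ i, (2 * Real.cosh (b i)) := by
    simp only [Real.exp_sum]
    rw [← Fintype.piFinset_univ, ← Finset.prod_univ_sum (fun _ => Finset.univ)
      (fun i (s : ℤˣ) => Real.exp (((s : ℤ) : ℝ) * b i))]
    refine Finset.prod_congr rfl fun i _ => ?_
    rw [sum_units_int, Real.cosh_eq]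
    simp; ring
  rw [h1, Finset.prod_mul_distrib, Finset.prod_const, Finset.card_univ]
  gcongr
  calc ∏ i, Real.cosh (b i) ≤ ∏ i, Real.exp (b i ^ 2 / 2) := by
        gcongr with i
        exact Real.cosh_le_exp_half_sq _
    _ = _ := by rw [← Real.exp_sum, ← Finset.sum_div, hb]

/-- After normalization to unit variance, `x^(2r) ≤ (2r)! e^{|x|} ≤ (2r)! (e^x + e^{-x})`, and the
exponential moment bound applies to both terms. -/
theorem sum_signs_pow_le (a : ι → ℝ) {r : ℕ} (hr : 1 ≤ r) :
    ∑ e : ι → ℤˣ, (∑ i, ((e i : ℤ) : ℝ) * a i) ^ (2 * r) ≤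
      2 ^ Fintype.card ι * ((2 * r).factorial * (2 * Real.exp (1 / 2))) * (∑ i, a i ^ 2) ^ r := by
  have hnn : 0 ≤ ∑ i, a i ^ 2 := Finset.sum_nonneg fun i _ => sq_nonneg _
  rcases hnn.eq_or_lt with h0 | hpos
  · have ha : ∀ i, a i = 0 := fun i => by
      simpa using (Finset.sum_eq_zero_iff_of_nonneg fun i _ => sq_nonneg (a i)).1 h0.symm i
        (Finset.mem_univ i)
    simp [ha, show r ≠ 0 by omega]
  · set σ := Real.sqrt (∑ i, a i ^ 2) with hσ
    have hσ0 : 0 < σ := Real.sqrt_pos.2 hpos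
    have hσ2 : σ ^ 2 = ∑ i, a i ^ 2 := Real.sq_sqrt hnn
    have hb : ∑ i, (a i / σ) ^ 2 = 1 := by
      simp only [div_pow, ← Finset.sum_div]; rw [← hσ2]; field_simp
    have hb' : ∑ i, (-(a i / σ)) ^ 2 = 1 := by simpa using hb
    have key : ∀ e : ι → ℤˣ, (∑ i, ((e i : ℤ) : ℝ) * a i) ^ (2 * r) ≤
        σ ^ (2 * r) * (2 * r).factorial * (Real.exp (∑ i, ((e i : ℤ) : ℝ) * (a i / σ)) +
          Real.exp (∑ i, ((e i : ℤ) : ℝ) * (-(a i / σ)))) := by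
      intro e
      set x := ∑ i, ((e i : ℤ) : ℝ) * (a i / σ) with hx
      have e1 : ∑ i, ((e i : ℤ) : ℝ) * a i = σ * x := by
        rw [hx, Finset.mul_sum]
        exact Finset.sum_congr rfl fun i _ => by field_simp
      have e2 : ∑ i, ((e i : ℤ) : ℝ) * (-(a i / σ)) = -x := by
        simp [hx, Finset.sum_neg_distrib]
      rw [e1, e2, mul_pow, mul_assoc]
      gcongr
      have h := Real.pow_div_factorial_le_exp |x| (abs_nonneg x) (2 * r)
      rw [div_le_iff₀ (by positivity), (even_two_mul r).pow_abs] at h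
      refine h.trans ?_
      rw [mul_comm]
      gcongr
      rcases abs_choice x with h | h <;> rw [h] <;>
        linarith [Real.exp_pos x, Real.exp_pos (-x)]
    calc _ ≤ ∑ e : ι → ℤˣ, _ := Finset.sum_le_sum fun e _ => key e
      _ = σ ^ (2 * r) * (2 * r).factorial *
          (∑ e : ι → ℤˣ, Real.exp (∑ i, ((e i : ℤ) : ℝ) * (a i / σ)) +
            ∑ e : ι → ℤˣ, Real.exp (∑ i, ((e i : ℤ) : ℝ) * (-(a i / σ)))) := by
          rw [← Finset.mul_sum, Finset.sum_add_distrib]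
      _ ≤ σ ^ (2 * r) * (2 * r).factorial * (2 ^ Fintype.card ι * Real.exp (1 / 2) +
            2 ^ Fintype.card ι * Real.exp (1 / 2)) := by
          gcongr
          · exact sum_signs_exp _ hb
          · exact sum_signs_exp _ hb'
      _ = _ := by rw [pow_mul, hσ2]; ring

/-- The constant in Khinchine's inequality. -/
def khinchineConst (r : ℕ) : ℝ := 2 ^ r * (2 * ((2 * r).factorial * (2 * Real.exp (1 / 2))))

theorem khinchineConst_pos (r : ℕ) : 0 < khinchineConst r := by
  unfold khinchineConst; positivity

/-- Splitting into real and imaginary parts costs the factors `2 ^ r` and `2` in `khinchineConst`.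
-/
theorem sum_signs_le_pow_sum_norm_sq (a : ι → ℂ) {r : ℕ} (hr : 1 ≤ r) :
    ∑ e : ι → ℤˣ, ‖∑ i, ((e i : ℤ) : ℂ) * a i‖ ^ (2 * r) ≤
      2 ^ Fintype.card ι * khinchineConst r * (∑ i, ‖a i‖ ^ 2) ^ r := by
  have key : ∀ z : ℂ, ‖z‖ ^ (2 * r) ≤ 2 ^ r * (z.re ^ (2 * r) + z.im ^ (2 * r)) := by
    intro z
    rw [pow_mul, ← Complex.normSq_eq_norm_sq, Complex.normSq_apply, pow_mul, pow_mul]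
    refine (add_pow_le (mul_self_nonneg _) (mul_self_nonneg _) r).trans ?_
    rw [← sq, ← sq]
    gcongr
    · norm_num
    · omega
  have hre : ∀ e : ι → ℤˣ, (∑ i, ((e i : ℤ) : ℂ) * a i).re = ∑ i, ((e i : ℤ) : ℝ) * (a i).re := by
    intro e; simp
  have him : ∀ e : ι → ℤˣ, (∑ i, ((e i : ℤ) : ℂ) * a i).im = ∑ i, ((e i : ℤ) : ℝ) * (a i).im := by
    intro e; simp
  have hre' : ∑ i, (a i).re ^ 2 ≤ ∑ i, ‖a i‖ ^ 2 := by
    refine Finset.sum_le_sum fun i _ => ?_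
    exact sq_le_sq' (abs_le.1 (Complex.abs_re_le_norm (a i))).1 (Complex.re_le_norm (a i))
  have him' : ∑ i, (a i).im ^ 2 ≤ ∑ i, ‖a i‖ ^ 2 := by
    refine Finset.sum_le_sum fun i _ => ?_
    exact sq_le_sq' (abs_le.1 (Complex.abs_im_le_norm (a i))).1 (Complex.im_le_norm (a i))
  set K : ℝ := (2 * r).factorial * (2 * Real.exp (1 / 2)) with hK
  have hK0 : 0 ≤ K := by positivity
  calc _ ≤ ∑ e : ι → ℤˣ, 2 ^ r * ((∑ i, ((e i : ℤ) : ℝ) * (a i).re) ^ (2 * r) +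
            (∑ i, ((e i : ℤ) : ℝ) * (a i).im) ^ (2 * r)) := by
          refine Finset.sum_le_sum fun e _ => ?_
          rw [← hre, ← him]; exact key _
    _ ≤ 2 ^ r * (2 ^ Fintype.card ι * K * (∑ i, (a i).re ^ 2) ^ r +
          2 ^ Fintype.card ι * K * (∑ i, (a i).im ^ 2) ^ r) := by
        rw [← Finset.mul_sum, Finset.sum_add_distrib]
        gcongr
        · exact sum_signs_pow_le _ hr
        · exact sum_signs_pow_le _ hr
    _ ≤ 2 ^ r * (2 ^ Fintype.card ι * K * (∑ i, ‖a i‖ ^ 2) ^ r +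
          2 ^ Fintype.card ι * K * (∑ i, ‖a i‖ ^ 2) ^ r) := by
        gcongr
    _ = _ := by rw [khinchineConst, ← hK]; ring

/-- Marcinkiewicz–Zygmund: a scalar `ℓ^{2r}` bound for a linear operator self-improves to a bound
for square functions. -/
theorem marcinkiewicz_zygmund {α β : Type*} (X : Finset α) (S : Finset β) (k : α → β → ℂ)
    {r : ℕ} (hr : 1 ≤ r) {B : ℝ} (hB0 : 0 ≤ B)
    (hB : ∀ h : β → ℂ, ∑ x ∈ X, ‖∑ y ∈ S, k x y * h y‖ ^ (2 * r) ≤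
      B * ∑ y ∈ S, ‖h y‖ ^ (2 * r)) (h : ι → β → ℂ) :
    ∑ x ∈ X, (∑ i, ‖∑ y ∈ S, k x y * h i y‖ ^ 2) ^ r ≤
      B * khinchineConst r * ∑ y ∈ S, (∑ i, ‖h i y‖ ^ 2) ^ r := by
  have h2 : (0 : ℝ) < 2 ^ Fintype.card ι := by positivity
  refine le_of_mul_le_mul_left ?_ h2
  calc 2 ^ Fintype.card ι * ∑ x ∈ X, (∑ i, ‖∑ y ∈ S, k x y * h i y‖ ^ 2) ^ r
      ≤ ∑ x ∈ X, ∑ e : ι → ℤˣ, ‖∑ i, ((e i : ℤ) : ℂ) * ∑ y ∈ S, k x y * h i y‖ ^ (2 * r) := by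
        rw [Finset.mul_sum]
        exact Finset.sum_le_sum fun x _ => pow_sum_norm_sq_le_sum_signs _ hr
    _ = ∑ e : ι → ℤˣ, ∑ x ∈ X, ‖∑ y ∈ S, k x y * ∑ i, ((e i : ℤ) : ℂ) * h i y‖ ^ (2 * r) := by
        rw [Finset.sum_comm]
        refine Finset.sum_congr rfl fun e _ => Finset.sum_congr rfl fun x _ => ?_
        congr 2
        simp only [Finset.mul_sum]
        rw [Finset.sum_comm]
        exact Finset.sum_congr rfl fun y _ => Finset.sum_congr rfl fun i _ => by ring
    _ ≤ ∑ e : ι → ℤˣ, B * ∑ y ∈ S, ‖∑ i, ((e i : ℤ) : ℂ) * h i y‖ ^ (2 * r) :=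
        Finset.sum_le_sum fun e _ => hB _
    _ = B * ∑ y ∈ S, ∑ e : ι → ℤˣ, ‖∑ i, ((e i : ℤ) : ℂ) * h i y‖ ^ (2 * r) := by
        rw [← Finset.mul_sum, Finset.sum_comm]
    _ ≤ B * ∑ y ∈ S, 2 ^ Fintype.card ι * khinchineConst r * (∑ i, ‖h i y‖ ^ 2) ^ r := by
        gcongr with y
        exact sum_signs_le_pow_sum_norm_sq _ hr
    _ = _ := by rw [← Finset.mul_sum]; ring

end Khinchine

/-! ### Convolution operators on `ℤ^d` -/

section Lattice

variable {d : ℕ}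

/-- Division with remainder by `Q` in every coordinate. -/
def residueEquiv (d Q : ℕ) [NeZero Q] : Zd d ≃ Zd d × (Fin d → Fin Q) :=
  (Equiv.piCongrRight fun _ => Int.divModEquiv Q).trans
    (Equiv.arrowProdEquivProdArrow (Fin d) (fun _ => ℤ) (fun _ => Fin Q))

theorem residueEquiv_symm_apply (Q : ℕ) [NeZero Q] (n : Zd d) (s : Fin d → Fin Q) (i : Fin d) :
    (residueEquiv d Q).symm (n, s) i = n i * Q + ((s i : ℕ) : ℤ) := rfl

theorem residueEquiv_symm_sub (Q : ℕ) [NeZero Q] (n m : Zd d) (s : Fin d → Fin Q) :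
    (residueEquiv d Q).symm (n, s) - (residueEquiv d Q).symm (m, s) = (Q : ℤ) • (n - m) := by
  ext i
  simp only [Pi.sub_apply, residueEquiv_symm_apply, Pi.smul_apply, smul_eq_mul]
  ring

theorem residueEquiv_snd_eq {Q : ℕ} [NeZero Q] {n : Zd d} {s : Fin d → Fin Q} {y : Zd d}
    (h : ∀ i, (Q : ℤ) ∣ ((residueEquiv d Q).symm (n, s) - y) i) : (residueEquiv d Q y).2 = s := by
  obtain ⟨⟨m, t⟩, rfl⟩ := (residueEquiv d Q).symm.surjective y
  rw [Equiv.apply_symm_apply]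
  ext i
  have hi := h i
  simp only [Pi.sub_apply, residueEquiv_symm_apply] at hi
  have h1 : (Q : ℤ) ∣ ((s i : ℕ) : ℤ) - ((t i : ℕ) : ℤ) := by
    rw [show n i * Q + ((s i : ℕ) : ℤ) - (m i * Q + ((t i : ℕ) : ℤ)) =
      (Q : ℤ) * (n i - m i) + (((s i : ℕ) : ℤ) - ((t i : ℕ) : ℤ)) by ring] at hi
    exact (dvd_add_right (dvd_mul_right _ _)).1 hi
  have h2 := (t i).2
  have h3 := (s i).2
  have h4 := Int.eq_zero_of_abs_lt_dvd h1 (by rw [abs_lt]; omega)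
  simp only
  omega

/-- A kernel carried by `Qℤ^d` maps each residue class mod `Q` to itself, acting there as
convolution with `κ`. The `p`-th powers of the norms add over the classes, so the constant is
unchanged. -/
theorem tsum_convolution_le_of_residues {Q : ℕ} [NeZero Q] {k κ : Zd d → ℂ}
    (hk : ∀ n, (¬ ∀ i, (Q : ℤ) ∣ n i) → k n = 0) (hκ : ∀ n, k ((Q : ℤ) • n) = κ n) {p : ℝ}
    (hp : 0 < p) {B : ℝ≥0∞}
    (hB : ∀ (S : Finset (Zd d)) (h : Zd d → ℂ),
      ∑' n, ‖∑ m ∈ S, κ (n - m) * h m‖ₑ ^ p ≤ B * ∑ m ∈ S, ‖h m‖ₑ ^ p)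
    (S : Finset (Zd d)) (h : Zd d → ℂ) :
    ∑' n, ‖∑ m ∈ S, k (n - m) * h m‖ₑ ^ p ≤ B * ∑ m ∈ S, ‖h m‖ₑ ^ p := by
  classical
  set e := residueEquiv d Q with he
  set T : Finset (Zd d) := S.image fun y => (e y).1 with hT
  -- Extension by zero is needed because a quotient in `T` combined with another residue may give a
  -- point outside `S`.
  set h' : Zd d → ℂ := fun y => if y ∈ S then h y else 0 with hh'
  have hzero : (0 : ℝ≥0∞) ^ p = 0 := ENNReal.zero_rpow_of_pos hp
  have key : ∀ (n : Zd d) (s : Fin d → Fin Q), ∑ y ∈ S, k (e.symm (n, s) - y) * h y =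
      ∑ m ∈ T, κ (n - m) * h' (e.symm (m, s)) := by
    intro n s
    rw [← Finset.sum_filter_of_ne (s := S) (p := fun y => (e y).2 = s),
      ← Finset.sum_filter_of_ne (s := T) (p := fun m => e.symm (m, s) ∈ S)]
    · refine Finset.sum_nbij' (fun y => (e y).1) (fun m => e.symm (m, s)) ?_ ?_ ?_ ?_ ?_
      · intro y hy
        obtain ⟨hyS, rfl⟩ := Finset.mem_filter.1 hy
        simp only [Finset.mem_filter, Prod.mk.eta, Equiv.symm_apply_apply, hyS, and_true]
        exact Finset.mem_image.2 ⟨y, hyS, rfl⟩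
      · intro m hm
        simpa using (Finset.mem_filter.1 hm).2
      · intro y hy
        obtain ⟨hy, rfl⟩ := Finset.mem_filter.1 hy
        simp
      · intro m hm
        simp
      · intro y hy
        obtain ⟨hyS, rfl⟩ := Finset.mem_filter.1 hy
        have h1 : h' (e.symm ((e y).1, (e y).2)) = h y := by simp [hh', hyS]
        have h2 : k (e.symm (n, (e y).2) - y) = κ (n - (e y).1) := by
          rw [← hκ, ← residueEquiv_symm_sub Q n (e y).1 (e y).2, ← he]
          simp
        rw [h1, h2]
    · intro m _ hm
      by_contra hn
      exact hm (by simp [hh', hn])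
    · intro y _ hy
      by_contra hn
      exact hy (by rw [hk _ fun hd => hn (residueEquiv_snd_eq hd), zero_mul])
  calc ∑' x, ‖∑ y ∈ S, k (x - y) * h y‖ₑ ^ p
      = ∑' (s : Fin d → Fin Q) (n : Zd d), ‖∑ m ∈ T, κ (n - m) * h' (e.symm (m, s))‖ₑ ^ p := by
        rw [← e.symm.tsum_eq, ENNReal.tsum_prod', ENNReal.tsum_comm]
        simp only [key]
    _ ≤ ∑' s : Fin d → Fin Q, B * ∑' m : Zd d, ‖h' (e.symm (m, s))‖ₑ ^ p := by
        refine ENNReal.tsum_le_tsum fun s => (hB T _).trans ?_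
        gcongr
        exact ENNReal.sum_le_tsum _
    _ = B * ∑' y, ‖h' y‖ₑ ^ p := by
        rw [ENNReal.tsum_mul_left, ← e.symm.tsum_eq, ENNReal.tsum_prod', ENNReal.tsum_comm]
    _ = _ := by
        rw [tsum_eq_sum (s := S) fun y hy => by simp [hh', hy, hzero]]
        congr 1
        exact Finset.sum_congr rfl fun y hy => by simp [hh', hy]

theorem tsum_mul_lt_top {α : Type*} {p q : ℝ} (hpq : p.HolderConjugate q)
    {a b : α → ℝ≥0∞} (ha : ∑' n, a n ^ q ≠ ⊤) (hb : ∑' n, b n ^ p ≠ ⊤) : ∑' n, a n * b n ≠ ⊤ := by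
  let _ : MeasurableSpace α := ⊤
  have h := ENNReal.lintegral_mul_le_Lp_mul_Lq (Measure.count : Measure α) hpq.symm (f := a) (g := b)
    measurable_from_top.aemeasurable measurable_from_top.aemeasurable
  simp only [Pi.mul_apply, lintegral_count] at h
  refine ne_top_of_le_ne_top (ENNReal.mul_ne_top ?_ ?_) h
  · exact ENNReal.rpow_ne_top_of_nonneg (by have := hpq.symm.pos; positivity) ha
  · exact ENNReal.rpow_ne_top_of_nonneg (by have := hpq.pos; positivity) hb

theorem tsum_convolution_rpow_le {p : ℝ} (hp : 1 < p) (e f : Zd d → ℝ≥0∞) :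
    ∑' y, (∑' z, e (y - z) * f z) ^ p ≤ (∑' n, e n) ^ (p - 1) * (∑' n, e n) * ∑' z, f z ^ p := by
  have h := schur_test (μ := (Measure.count : Measure (Zd d)))
    (ν := (Measure.count : Measure (Zd d))) hp (k := fun y z => e (y - z)) (g := f)
    (a := ∑' n, e n) (b := ∑' n, e n) (measurable_of_countable _)
    (measurable_of_countable _).aemeasurable
    (fun x => by rw [lintegral_count, ← (Equiv.subLeft x).tsum_eq e]; rfl)
    (fun y => by rw [lintegral_count, ← (Equiv.subRight y).tsum_eq e]; rfl)
  simpa only [lintegral_count] using h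

theorem summable_of_tsum_enorm_ne_top {α : Type*} {a : α → ℂ} (h : ∑' n, ‖a n‖ₑ ≠ ⊤) :
    Summable a := by
  refine Summable.of_norm ?_
  exact NNReal.summable_coe.2 ((ENNReal.tsum_coe_ne_top_iff_summable (f := fun n => ‖a n‖₊)).1 h)

/-- The multiplier `K E` is the composition of the multipliers `E` and `K`. -/
theorem latticeMult_mul {K E : Td d → ℂ} (hK : Integrable K (torusMeasure d)) (hE : Continuous E)
    {p q : ℝ} (hpq : p.HolderConjugate q)
    (hk : ∑' n, ‖UnitAddTorus.mFourierCoeff K n‖ₑ ^ q ≠ ⊤)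
    (he : ∑' n, ‖UnitAddTorus.mFourierCoeff E n‖ₑ ≠ ⊤) {f : Zd d → ℂ}
    (hf : ∑' n, ‖f n‖ₑ ^ p ≠ ⊤) (x : Zd d) :
    latticeMult (fun t => K t * E t) f x = latticeMult K (latticeMult E f) x := by
  set k := UnitAddTorus.mFourierCoeff K with hkdef
  set e := UnitAddTorus.mFourierCoeff E with hedef
  have hes : Summable e := summable_of_tsum_enorm_ne_top he
  -- The coefficients of a product are a convolution: `latticeMult_eq` is applied with the summable
  -- sequence `e` in place of `f`, whose Fourier series is `E`.
  have hKE : ∀ n, UnitAddTorus.mFourierCoeff (fun t => K t * E t) n = ∑' y, k (n - y) * e y := by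
    intro n
    have h1 := latticeMult_eq K hK e hes n
    rw [latticeMult] at h1
    rw [h1]
    congr 1
    ext t
    congr 1
    have := UnitAddTorus.hasSum_mFourier_series_apply_of_summable (f := ⟨E, hE⟩) hes t
    exact this.tsum_eq.symm
  -- Absolute convergence of the double sum: `|e| * |f|` is in `ℓ^p` by Young's inequality, and `k`
  -- is in `ℓ^q`, so Hölder's inequality applies.
  have hfin : ∑' y, ‖k (x - y)‖ₑ * ∑' z, ‖e (y - z)‖ₑ * ‖f z‖ₑ ≠ ⊤ := by
    refine tsum_mul_lt_top hpq ?_ ?_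
    · rwa [← (Equiv.subLeft x).tsum_eq] at hk
    · refine ne_top_of_le_ne_top ?_
        (tsum_convolution_rpow_le hpq.lt (fun n => ‖e n‖ₑ) (fun n => ‖f n‖ₑ))
      exact ENNReal.mul_ne_top (ENNReal.mul_ne_top
        (ENNReal.rpow_ne_top_of_nonneg (by linarith [hpq.lt]) he) he) hf
  have hsum : Summable (Function.uncurry fun y z : Zd d => k (x - y) * e (y - z) * f z) := by
    refine summable_of_tsum_enorm_ne_top ?_
    rw [ENNReal.tsum_prod']
    simpa only [Function.uncurry_apply_pair, enorm_mul, mul_assoc, ENNReal.tsum_mul_left] using hfin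
  calc latticeMult (fun t => K t * E t) f x
      = ∑' z, ∑' y, k (x - y) * e (y - z) * f z := by
        rw [latticeMult]
        congr 1; ext z
        rw [hKE, ← tsum_mul_right, ← (Equiv.subRight z).tsum_eq]
        congr 1; ext y
        simp [sub_sub_sub_cancel_right]
    _ = ∑' y, ∑' z, k (x - y) * e (y - z) * f z := hsum.tsum_comm
    _ = _ := by
        rw [latticeMult]
        congr 1; ext y
        rw [latticeMult, ← tsum_mul_left]
        congr 1; ext z
        ring

theorem latticeMult_sum {ι : Type*} (s : Finset ι) {m : ι → Td d → ℂ}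
    (hm : ∀ i ∈ s, Integrable (m i) (torusMeasure d)) {f : Zd d → ℂ} {x : Zd d}
    (hs : ∀ i ∈ s, Summable fun y => UnitAddTorus.mFourierCoeff (m i) (x - y) * f y) :
    latticeMult (fun t => ∑ i ∈ s, m i t) f x = ∑ i ∈ s, latticeMult (m i) f x := by
  simp only [latticeMult, mFourierCoeff_sum s hm, Finset.sum_mul]
  exact Summable.tsum_finsetSum hs

theorem latticeMult_const_mul (c : ℂ) (m : Td d → ℂ) (f : Zd d → ℂ) (x : Zd d) :
    latticeMult (fun t => c * m t) f x = c * latticeMult m f x := by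
  simp only [latticeMult, mFourierCoeff_const_mul, mul_assoc, tsum_mul_left]

/-- Translating a multiplier amounts to modulating. -/
theorem norm_latticeMult_comp_sub (m : Td d → ℂ) (w : Td d) (f : Zd d → ℂ) (x : Zd d) :
    ‖latticeMult (fun t => m (t - w)) f x‖ =
      ‖latticeMult m (fun y => UnitAddTorus.mFourier y w * f y) x‖ := by
  have : latticeMult (fun t => m (t - w)) f x = UnitAddTorus.mFourier (-x) w *
      latticeMult m (fun y => UnitAddTorus.mFourier y w * f y) x := by
    simp only [latticeMult, mFourierCoeff_comp_sub, ← tsum_mul_left]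
    congr 1; ext y
    rw [show -(x - y) = -x + y by abel, UnitAddTorus.mFourier_add]
    ring
  rw [this, norm_mul, norm_mFourier_apply, one_mul]

/-- The passage from finitely supported functions to `ℓ^{2r}`, for square functions. -/
theorem tsum_squareFn_le {ι : Type*} [Fintype ι] {k : Zd d → ℂ} {r : ℕ} (hr : 1 ≤ r) {B : ℝ}
    (hB0 : 0 ≤ B)
    (hB : ∀ (S : Finset (Zd d)) (h : Zd d → ℂ),
      ∑' n, ‖∑ m ∈ S, k (n - m) * h m‖ₑ ^ ((2 * r : ℕ) : ℝ) ≤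
        ENNReal.ofReal B * ∑ m ∈ S, ‖h m‖ₑ ^ ((2 * r : ℕ) : ℝ))
    {h : ι → Zd d → ℂ} (hs : ∀ i x, Summable fun y => k (x - y) * h i y) :
    ∑' x, ENNReal.ofReal ((∑ i, ‖∑' y, k (x - y) * h i y‖ ^ 2) ^ r) ≤
      ENNReal.ofReal (B * khinchineConst r) * ∑' y, ENNReal.ofReal ((∑ i, ‖h i y‖ ^ 2) ^ r) := by
  classical
  refine ENNReal.summable.tsum_le_of_sum_le fun X => ?_
  have hfin : ∀ S : Finset (Zd d),
      ∑ x ∈ X, ENNReal.ofReal ((∑ i, ‖∑ y ∈ S, k (x - y) * h i y‖ ^ 2) ^ r) ≤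
      ENNReal.ofReal (B * khinchineConst r) * ∑' y, ENNReal.ofReal ((∑ i, ‖h i y‖ ^ 2) ^ r) := by
    intro S
    have hmz := marcinkiewicz_zygmund X S (fun x y => k (x - y)) hr hB0 (fun g => ?_) h
    · calc _ = ENNReal.ofReal (∑ x ∈ X, (∑ i, ‖∑ y ∈ S, k (x - y) * h i y‖ ^ 2) ^ r) := by
            rw [ENNReal.ofReal_sum_of_nonneg fun _ _ => by positivity]
        _ ≤ _ := ENNReal.ofReal_le_ofReal hmz
        _ = ENNReal.ofReal (B * khinchineConst r) *
            ∑ y ∈ S, ENNReal.ofReal ((∑ i, ‖h i y‖ ^ 2) ^ r) := by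
            rw [ENNReal.ofReal_mul (mul_nonneg hB0 (khinchineConst_pos r).le),
              ENNReal.ofReal_sum_of_nonneg fun _ _ => by positivity]
        _ ≤ _ := by gcongr; exact ENNReal.sum_le_tsum _
    · have h1 := (ENNReal.sum_le_tsum X).trans (hB S g)
      have h2 : ∀ z : ℂ, ‖z‖ₑ ^ ((2 * r : ℕ) : ℝ) = ENNReal.ofReal (‖z‖ ^ (2 * r)) := by
        intro z
        rw [ENNReal.rpow_natCast, ENNReal.ofReal_pow (norm_nonneg _), ofReal_norm]
      simp only [h2] at h1
      rw [← ENNReal.ofReal_sum_of_nonneg fun _ _ => by positivity,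
        ← ENNReal.ofReal_sum_of_nonneg fun _ _ => by positivity, ← ENNReal.ofReal_mul hB0] at h1
      exact (ENNReal.ofReal_le_ofReal_iff (mul_nonneg hB0
        (Finset.sum_nonneg fun _ _ => by positivity))).1 h1
  refine le_of_tendsto' (x := Filter.atTop) (f := fun S : Finset (Zd d) =>
    ∑ x ∈ X, ENNReal.ofReal ((∑ i, ‖∑ y ∈ S, k (x - y) * h i y‖ ^ 2) ^ r)) ?_ hfin
  refine tendsto_finsetSum _ fun x _ => ENNReal.tendsto_ofReal ?_
  refine (tendsto_finsetSum _ fun i _ => ?_).pow r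
  exact ((hs i x).hasSum.norm).pow 2

end Lattice

/-! ### Rational points of the torus -/

section RationalPoints

variable {d : ℕ}

theorem nsmul_ratPt {Q : ℕ} (hQ : Q ≠ 0) (b : Fin d → ℕ) : Q • ratPt Q b = 0 := by
  ext i
  have hQ' : (Q : ℝ) ≠ 0 := by exact_mod_cast hQ
  rw [Pi.smul_apply, ratPt, ← AddCircle.coe_nsmul, Pi.zero_apply, AddCircle.coe_eq_zero_iff]
  exact ⟨b i, by simp; field_simp⟩

theorem nsmul_ratPt_eq_zero_iff {q : ℕ} (hq : q ≠ 0) (a : Fin d → ℕ) (n : ℕ) :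
    n • ratPt q a = 0 ↔ ∀ i, q ∣ n * a i := by
  have hq' : (q : ℝ) ≠ 0 := by exact_mod_cast hq
  rw [funext_iff]
  refine forall_congr' fun i => ?_
  rw [Pi.smul_apply, ratPt, ← AddCircle.coe_nsmul, Pi.zero_apply, AddCircle.coe_eq_zero_iff,
    ← Int.natCast_dvd_natCast]
  constructor
  · rintro ⟨m, hm⟩
    refine ⟨m, ?_⟩
    simp only [zsmul_eq_mul, mul_one, nsmul_eq_mul] at hm
    field_simp at hm
    have : ((n * a i : ℕ) : ℝ) = ((q * m : ℤ) : ℝ) := by push_cast; linarith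
    exact_mod_cast this
  · rintro ⟨m, hm⟩
    refine ⟨m, ?_⟩
    simp only [zsmul_eq_mul, mul_one, nsmul_eq_mul]
    have : (n : ℝ) * a i = q * m := by exact_mod_cast hm
    field_simp
    linarith

/-- The order times each `a i` is divisible by `q`, hence so is the order times the gcd of the `a
i`, and this gcd is coprime to `q`. -/
theorem addOrderOf_ratPt {q : ℕ} (hq : q ≠ 0) {a : Fin d → ℕ} (ha : a ∈ Aset d q) :
    addOrderOf (ratPt q a) = q := by
  refine Nat.dvd_antisymm (addOrderOf_dvd_of_nsmul_eq_zero (nsmul_ratPt hq a)) ?_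
  have h := (nsmul_ratPt_eq_zero_iff hq a _).1 (addOrderOf_nsmul_eq_zero (ratPt q a))
  have hg : q ∣ addOrderOf (ratPt q a) * Finset.univ.gcd a := by
    rw [← normalize_eq (addOrderOf (ratPt q a)), ← Finset.gcd_mul_left]
    exact Finset.dvd_gcd fun i _ => h i
  exact Nat.Coprime.dvd_of_dvd_mul_right (Finset.mem_filter.1 ha).2 hg

theorem exists_mem_box_ratPt_eq {Q : ℕ} (hQ : Q ≠ 0) {t : Td d} (ht : Q • t = 0) :
    ∃ b ∈ box d Q, ratPt Q b = t := by
  have hQ' : (Q : ℝ) ≠ 0 := by exact_mod_cast hQ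
  have h : ∀ i, ∃ a : ℕ, a ∈ Finset.Icc 1 Q ∧ (((a : ℝ) / (Q : ℝ) : ℝ) : UnitAddCircle) = t i := by
    intro i
    obtain ⟨m, hm, hmt⟩ := (AddCircle.nsmul_eq_zero_iff (Nat.pos_of_ne_zero hQ)).1 (congrFun ht i)
    rcases Nat.eq_zero_or_pos m with rfl | hpos
    · refine ⟨Q, Finset.mem_Icc.2 ⟨Nat.pos_of_ne_zero hQ, le_rfl⟩, ?_⟩
      rw [← hmt, div_self hQ']
      simp
    · exact ⟨m, Finset.mem_Icc.2 ⟨hpos, hm.le⟩, by rw [← hmt, mul_one]⟩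
  choose b hb hbt using h
  exact ⟨b, Fintype.mem_piFinset.2 hb, funext hbt⟩

theorem ratPt_injOn_box {Q : ℕ} (hQ : Q ≠ 0) : Set.InjOn (ratPt (d := d) Q) (box d Q) := by
  have hQ' : (0 : ℝ) < Q := by exact_mod_cast Nat.pos_of_ne_zero hQ
  intro b hb b' hb' h
  ext i
  have hbi := Finset.mem_Icc.1 (Fintype.mem_piFinset.1 hb i)
  have hbi' := Finset.mem_Icc.1 (Fintype.mem_piFinset.1 hb' i)
  have hi := congrFun h i
  simp only [ratPt] at hi
  rw [← sub_eq_zero, ← AddCircle.coe_sub, AddCircle.coe_eq_zero_iff] at hi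
  obtain ⟨m, hm⟩ := hi
  simp only [zsmul_eq_mul, mul_one] at hm
  have h1 : ((m * Q : ℤ) : ℝ) = ((b i - b' i : ℤ) : ℝ) := by
    push_cast; rw [hm]; field_simp
  have h2 : m * Q = (b i : ℤ) - b' i := by exact_mod_cast h1
  have h3 := Int.eq_zero_of_abs_lt_dvd (Dvd.intro_left m h2) (by rw [abs_lt]; omega)
  omega

/-- Distinct `Q`-torsion points are `1/Q`-separated in some coordinate. -/
theorem exists_le_norm_of_nsmul_eq_zero {Q : ℕ} (hQ : Q ≠ 0) {t : Td d} (ht : Q • t = 0)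
    (h0 : t ≠ 0) : ∃ i, 1 ≤ Q * ‖t i‖ := by
  obtain ⟨i, hi⟩ := Function.ne_iff.1 h0
  have hti : Q • t i = 0 := congrFun ht i
  refine ⟨i, ?_⟩
  have hfin : IsOfFinAddOrder (t i) :=
    isOfFinAddOrder_iff_nsmul_eq_zero.2 ⟨Q, Nat.pos_of_ne_zero hQ, hti⟩
  have h := AddCircle.le_add_order_smul_norm_of_isOfFinAddOrder hfin hi
  rw [nsmul_eq_mul] at h
  refine h.trans ?_
  gcongr
  exact Nat.le_of_dvd (Nat.pos_of_ne_zero hQ) (addOrderOf_dvd_of_nsmul_eq_zero hti)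

end RationalPoints

/-! ### Factorization of the multipliers -/

section Factorization

variable {d : ℕ} {Θ e : Rd d → ℂ} {Q : ℕ}

/-- Where the bump of `e` at `β` is nonzero, `ξ - w` is within `1/(8Q)` of `β`, so it is at least
`7/(8Q)` from any other `Q`-torsion point in some coordinate. There the inner cutoff vanishes, while
at `β` itself it equals `1`. -/
theorem shiftSum_mul_onTorus (hQ : Q ≠ 0) (he : ∀ ξ, e ξ ≠ 0 → ‖(Q : ℝ) • ξ‖ ≤ 1 / 8) (w ξ : Td d)
    {β : Td d} (hβ : Q • β = 0) :
    shiftSum Q (fun ζ => Θ ζ * dilate Q (innerCut d) ζ) w ξ * onTorus e (ξ - β - w) =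
      onTorus (fun ζ => Θ ζ * e ζ) (ξ - β - w) := by
  by_cases h0 : onTorus e (ξ - β - w) = 0
  · rw [h0, mul_zero]
    simp only [onTorus] at h0 ⊢
    rw [h0, mul_zero]
  · have hsmall := he _ h0
    obtain ⟨b₀, hb₀, rfl⟩ := exists_mem_box_ratPt_eq hQ hβ
    rw [shiftSum, Finset.sum_eq_single b₀]
    · simp only [onTorus, dilate]
      rw [innerCut_eq_one hsmall, mul_one]
    · intro b hb hne
      have hδ : Q • (ratPt Q b₀ - ratPt Q b) = 0 := by
        rw [nsmul_sub, nsmul_ratPt hQ, nsmul_ratPt hQ, sub_zero]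
      have hδ0 : ratPt Q b₀ - ratPt Q b ≠ 0 := fun h =>
        hne (ratPt_injOn_box hQ hb hb₀ (sub_eq_zero.1 h).symm)
      obtain ⟨i, hi⟩ := exists_le_norm_of_nsmul_eq_zero hQ hδ hδ0
      simp only [onTorus, dilate]
      rw [innerCut_eq_zero, mul_zero]
      have h1 : Q * ‖(ξ - ratPt Q b₀ - w) i‖ ≤ 1 / 8 := by
        refine le_trans (le_of_eq ?_) ((norm_apply_le_norm _ i).trans hsmall)
        rw [← abs_torusRep, PiLp.smul_apply, smul_eq_mul, abs_mul, Nat.abs_cast]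
      have h2 : ‖(ratPt Q b₀ - ratPt Q b) i‖ ≤
          ‖(ξ - ratPt Q b - w) i‖ + ‖(ξ - ratPt Q b₀ - w) i‖ := by
        refine le_trans (le_of_eq ?_) (norm_sub_le _ _)
        simp only [Pi.sub_apply]; congr 1; abel
      have h3 : Q * ‖(ξ - ratPt Q b - w) i‖ ≤ ‖(Q : ℝ) • torusRep (ξ - ratPt Q b - w)‖ := by
        refine le_trans (le_of_eq ?_) (norm_apply_le_norm _ i)
        rw [← abs_torusRep, PiLp.smul_apply, smul_eq_mul, abs_mul, Nat.abs_cast]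
      have h4 := mul_le_mul_of_nonneg_left h2 (Nat.cast_nonneg (α := ℝ) Q)
      linarith
    · exact fun h => absurd hb₀ h

/-- All centres `b/Q' + v` are `Q`-torsion, so one outer multiplier serves all of them
simultaneously. -/
theorem shiftSum_mul_sum_shiftSum (hQ : Q ≠ 0) (he : ∀ ξ, e ξ ≠ 0 → ‖(Q : ℝ) • ξ‖ ≤ 1 / 8)
    {Q' : ℕ} (hQ' : Q' ≠ 0) (hdvd : Q' ∣ Q) (w ξ : Td d) (s : Finset (Td d))
    (hs : ∀ v ∈ s, Q • v = 0) :
    shiftSum Q (fun ζ => Θ ζ * dilate Q (innerCut d) ζ) w ξ * ∑ v ∈ s, shiftSum Q' e (w + v) ξ =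
      ∑ v ∈ s, shiftSum Q' (fun ζ => Θ ζ * e ζ) (w + v) ξ := by
  rw [Finset.mul_sum]
  refine Finset.sum_congr rfl fun v hv => ?_
  simp only [shiftSum.eq_def Q', Finset.mul_sum]
  refine Finset.sum_congr rfl fun b _ => ?_
  have hβ : Q • (ratPt Q' b + v) = 0 := by
    obtain ⟨c, rfl⟩ := hdvd
    rw [nsmul_add, hs v hv, add_zero, mul_comm, mul_nsmul', nsmul_ratPt hQ', smul_zero]
  have := shiftSum_mul_onTorus (Θ := Θ) hQ he w ξ hβ
  rwa [show ξ - (ratPt Q' b + v) - w = ξ - ratPt Q' b - (w + v) by abel] at this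

end Factorization

/-! ### The frequency sets -/

section Arithmetic

variable {d k D : ℕ} {P Λ : Set ℕ} {β : Fin k → ℕ} {q : (j : Fin k) → Fin (β j) → ℕ}

theorem mem_U {M : Finset (Fin k)} {x : Td d} :
    x ∈ U d q M ↔ ∃ u : Fin k → Td d, (∀ j ∈ M, u j ∈ Usingle d q j) ∧ ∑ j ∈ M, u j = x := by
  classical
  simp only [U, Finset.mem_image, Fintype.mem_piFinset]
  constructor
  · rintro ⟨u, hu, rfl⟩
    refine ⟨fun j => if h : j ∈ M then u ⟨j, h⟩ else 0, fun j hj => by simpa [hj] using hu ⟨j, hj⟩, ?_⟩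
    rw [← Finset.sum_coe_sort M]
    exact Finset.sum_congr rfl fun j _ => by simp
  · rintro ⟨u, hu, rfl⟩
    exact ⟨fun j => u j, fun j => hu j j.2, Finset.sum_coe_sort M u⟩

theorem mem_V {M : Finset (Fin k)} {σ : (j : M) → Fin (β j)} {x : Td d} :
    x ∈ V d q M σ ↔ ∃ u : Fin k → Td d,
      (∀ j (hj : j ∈ M), ∃ a ∈ Aset d (q j (σ ⟨j, hj⟩)), ratPt (q j (σ ⟨j, hj⟩)) a = u j) ∧
      ∑ j ∈ M, u j = x := by
  classical
  simp only [V, Finset.mem_image, Fintype.mem_piFinset]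
  constructor
  · rintro ⟨u, hu, rfl⟩
    refine ⟨fun j => if h : j ∈ M then u ⟨j, h⟩ else 0, fun j hj => by simpa [hj] using hu ⟨j, hj⟩, ?_⟩
    rw [← Finset.sum_coe_sort M]
    exact Finset.sum_congr rfl fun j _ => by simp
  · rintro ⟨u, hu, rfl⟩
    exact ⟨fun j => u j, fun j => hu j j.2, Finset.sum_coe_sort M u⟩

theorem mem_Usingle {j : Fin k} {x : Td d} :
    x ∈ Usingle d q j ↔ ∃ s, ∃ a ∈ Aset d (q j s), ratPt (q j s) a = x := by
  classical
  simp [Usingle]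

theorem addOrderOf_sum_of_coprime {ι G : Type*} [AddCommGroup G] (s : Finset ι) (u : ι → G)
    (h : ∀ i ∈ s, ∀ j ∈ s, i ≠ j → (addOrderOf (u i)).Coprime (addOrderOf (u j))) :
    addOrderOf (∑ i ∈ s, u i) = ∏ i ∈ s, addOrderOf (u i) := by
  classical
  induction s using Finset.induction_on with
  | empty => simp
  | insert a s ha ih =>
    have ih' := ih fun i hi j hj => h i (Finset.mem_insert_of_mem hi) j (Finset.mem_insert_of_mem hj)
    rw [Finset.sum_insert ha, Finset.prod_insert ha,
      (AddCommute.all _ _).addOrderOf_add_eq_mul_addOrderOf_of_coprime, ih']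
    rw [ih']
    refine Nat.Coprime.prod_right fun i hi => h a (Finset.mem_insert_self _ _) i
      (Finset.mem_insert_of_mem hi) ?_
    rintro rfl; exact ha hi

theorem IsOSystem.one_lt (hO : IsOSystem D P Λ k β q) (hP : ∀ p ∈ P, p.Prime) (j : Fin k)
    (s : Fin (β j)) : 1 < q j s := by
  obtain ⟨p, hp, γ, hγ, -, h⟩ := hO.prime_pow j s
  rw [h]
  exact Nat.one_lt_pow (by omega) (hP p hp).one_lt

/-- The order recovers the product of the denominators from the frequency alone, so the value of
`chi` does not depend on the chosen representation. -/
theorem IsOSystem.addOrderOf_of_mem_V (hO : IsOSystem D P Λ k β q) (hP : ∀ p ∈ P, p.Prime)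
    {s : (j : Fin k) → Fin (β j)} {x : Td d} (hx : x ∈ V d q Finset.univ fun j => s j) :
    addOrderOf x = ∏ j, q j (s j) := by
  obtain ⟨u, hu, rfl⟩ := mem_V.1 hx
  have ho : ∀ j, addOrderOf (u j) = q j (s j) := by
    intro j
    obtain ⟨a, ha, hau⟩ := hu j (Finset.mem_univ j)
    rw [← hau, addOrderOf_ratPt (Nat.zero_lt_of_lt (hO.one_lt hP _ _)).ne' ha]
  rw [addOrderOf_sum_of_coprime]
  · simp only [ho]
  · intro i _ j _ hij
    rw [ho, ho]
    exact hO.coprime _ _ _ _ fun h => hij (Sigma.mk.inj_iff.1 h).1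

/-- The factor `𝟙_Λ` is the same for all frequencies `w + v`, `v ∈ 𝓥_M^σ`. -/
theorem IsOSystem.exists_chi_eq (hO : IsOSystem D P Λ k β q) (hP : ∀ p ∈ P, p.Prime)
    (M : Finset (Fin k)) (σ : (j : M) → Fin (β j)) {w : Td d} (hw : w ∈ U d q Mᶜ) :
    ∃ c : ℂ, ‖c‖ ≤ 1 ∧ ∀ v ∈ V d q M σ, chi d q Λ (w + v) = c := by
  classical
  obtain ⟨uw, huw, rfl⟩ := mem_U.1 hw
  have ht : ∀ j ∈ Mᶜ, ∃ s, ∃ a ∈ Aset d (q j s), ratPt (q j s) a = uw j :=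
    fun j hj => mem_Usingle.1 (huw j hj)
  choose t ht using ht
  set s : (j : Fin k) → Fin (β j) := fun j =>
    if h : j ∈ M then σ ⟨j, h⟩ else t j (Finset.mem_compl.2 h) with hs
  have hsV : ∀ v ∈ V d q M σ,
      (∑ j ∈ Mᶜ, uw j) + v ∈ V d q Finset.univ fun j => s j := by
    intro v hv
    obtain ⟨uv, huv, rfl⟩ := mem_V.1 hv
    refine mem_V.2 ⟨fun j => if j ∈ M then uv j else uw j, fun j _ => ?_, ?_⟩
    · by_cases h : j ∈ M
      · simpa only [hs, h, dif_pos, if_true] using huv j h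
      · simpa only [hs, h, dif_neg, not_false_eq_true, if_false]
          using ht j (Finset.mem_compl.2 h)
    · rw [← Finset.sum_add_sum_compl M, add_comm]
      congr 1
      · exact Finset.sum_congr rfl fun j hj => if_neg (Finset.mem_compl.1 hj)
      · exact Finset.sum_congr rfl fun j hj => if_pos hj
  refine ⟨if ∏ j, q j (s j) ∈ Λ then 1 else 0, by split_ifs <;> simp, fun v hv => ?_⟩
  rw [chi]
  refine if_congr ⟨?_, fun h => ⟨s, hsV v hv, h⟩⟩ rfl rfl
  rintro ⟨s', hs', hΛ⟩
  -- The indices `s'` need not be compared with `s`: both products equal the order of the same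
  -- point.
  have h1 := hO.addOrderOf_of_mem_V hP hs'
  have h2 := hO.addOrderOf_of_mem_V hP (hsV v hv)
  rwa [← h2, h1]

theorem IsOSystem.nsmul_of_mem_V (hO : IsOSystem D P Λ k β q) (hP : ∀ p ∈ P, p.Prime)
    {M : Finset (Fin k)} {σ : (j : M) → Fin (β j)} {v : Td d} (hv : v ∈ V d q M σ) :
    (∏ j : M, q j (σ j)) • v = 0 := by
  obtain ⟨u, hu, rfl⟩ := mem_V.1 hv
  rw [Finset.smul_sum]
  refine Finset.sum_eq_zero fun j hj => ?_
  obtain ⟨a, -, ha⟩ := hu j hj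
  obtain ⟨c, hc⟩ := Finset.dvd_prod_of_mem (fun j : M => q j (σ j)) (Finset.mem_univ ⟨j, hj⟩)
  rw [← ha, hc, mul_comm, mul_nsmul',
    nsmul_ratPt (Nat.zero_lt_of_lt (hO.one_lt hP _ _)).ne', smul_zero]

/-- Pairwise coprimality makes the underlying primes distinct, and there are at most `k ≤ D` of
them. This places the common denominator in `P_N`, which bounds its size. -/
theorem IsOSystem.prod_mem_PiSet (hO : IsOSystem D P Λ k β q) (hP : ∀ p ∈ P, p.Prime)
    (M : Finset (Fin k)) (σ : (j : M) → Fin (β j)) : ∏ j : M, q j (σ j) ∈ PiSet D P ∪ {1} := by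
  classical
  rcases M.eq_empty_or_nonempty with rfl | hM
  · right; simp
  left
  choose p hp γ hγ1 hγD hpγ using fun j : M => hO.prime_pow j (σ j)
  have hinj : Function.Injective p := by
    intro i j hij
    by_contra hne
    have hc := hO.coprime i j (σ i) (σ j) fun h => hne (Subtype.ext (Sigma.mk.inj_iff.1 h).1)
    rw [hpγ, hpγ, ← hij] at hc
    have h1 := (Nat.coprime_pow_left_iff (hγ1 i) _ _).1 hc
    have h2 := (Nat.coprime_pow_right_iff (hγ1 j) _ _).1 h1
    exact (hP _ (hp i)).one_lt.ne' ((Nat.coprime_self _).1 h2)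
  have : Nonempty M := hM.to_subtype
  refine ⟨Finset.univ.image p, fun x => γ (Function.invFun p x), ?_, ?_, ?_, ?_, ?_⟩
  · intro x hx
    obtain ⟨j, -, rfl⟩ := Finset.mem_image.1 (Finset.mem_coe.1 hx)
    exact hp j
  · exact Finset.card_pos.2 (Finset.univ_nonempty.image p)
  · refine Finset.card_image_le.trans ?_
    rw [Finset.card_univ, Fintype.card_coe]
    exact ((Finset.card_le_univ M).trans_eq (Fintype.card_fin k)).trans hO.k_le
  · exact fun x _ => ⟨hγ1 _, hγD _⟩
  · rw [Finset.prod_image fun i _ j _ h => hinj h]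
    have hinv : ∀ j, Function.invFun p (p j) = j := Function.leftInverse_invFun hinj
    simp only [hinv, hpγ]

end Arithmetic

/-! ### The lattice kernels -/

section Kernels

variable {d : ℕ} {Θ : Rd d → ℂ}

theorem tsum_mFourierCoeff_shiftSum_ne_top {g : Rd d → ℂ} (hg : ∀ ξ, 1 / 2 ≤ ‖ξ‖ → g ξ = 0)
    (hi : Integrable g) {Q : ℕ} (hQ : Q ≠ 0) {s : ℝ} (hs : 0 < s)
    (h : ∑' n : Zd d, ‖𝓕 g (latticePt n)‖ₑ ^ s ≠ ⊤) (u : Td d) :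
    ∑' n, ‖UnitAddTorus.mFourierCoeff (shiftSum Q g u) n‖ₑ ^ s ≠ ⊤ := by
  have hb : ∑' n, ‖UnitAddTorus.mFourierCoeff (shiftSum Q g u) n‖ₑ ^ s ≤
      ‖(Q : ℂ) ^ d‖ₑ ^ s * ∑' n : Zd d, ‖𝓕 g (latticePt n)‖ₑ ^ s := by
    rw [← ENNReal.tsum_mul_left]
    refine ENNReal.tsum_le_tsum fun n => ?_
    rw [← ENNReal.mul_rpow_of_nonneg _ _ hs.le, mFourierCoeff_shiftSum hg hi hQ, enorm_mul,
      enorm_mul]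
    gcongr
    rw [← ofReal_norm (UnitAddTorus.mFourier (-n) u), norm_mFourier_apply, ENNReal.ofReal_one,
      one_mul]
    split_ifs <;> simp
  exact ne_top_of_le_ne_top (ENNReal.mul_ne_top
    (ENNReal.rpow_ne_top_of_nonneg hs.le enorm_ne_top) h) hb

/-- This is sampling with `Q = 1`. Applied at the exponent conjugate to `2r`, it makes convolution
with functions in `ℓ^{2r}` absolutely convergent. -/
theorem MultiplierBound.tsum_fourier_ne_top {s A : ℝ} (hs : 1 < s) (hΘ : MultiplierBound Θ s A)
    {b : Rd d → ℂ} (hb : ContDiff ℝ ∞ b) (hb' : HasCompactSupport b)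
    (hsupp : ∀ ξ, b ξ ≠ 0 → ‖ξ‖ ≤ 1 / 4) :
    ∑' n : Zd d, ‖𝓕 (fun ξ => Θ ξ * b ξ) (latticePt n)‖ₑ ^ s ≠ ⊤ := by
  obtain ⟨C, hC, h⟩ := exists_sampling d hs
  have h1 := h Θ A hΘ 1 one_ne_zero b hb hb' (by simpa using hsupp)
  simp only [Nat.cast_one, one_smul, one_pow, inv_one, mul_one] at h1
  refine ne_top_of_le_ne_top (ENNReal.mul_ne_top (ENNReal.mul_ne_top hC
    (ENNReal.rpow_ne_top_of_nonneg (by linarith) ENNReal.ofReal_ne_top)) ?_) h1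
  have hm := (𝓕 (hb'.toSchwartzMap hb) : SchwartzMap (Rd d) ℂ).memLp (ENNReal.ofReal s)
    (volume : Measure (Rd d))
  have := lintegral_rpow_enorm_lt_top_of_eLpNorm_lt_top (by simpa using by linarith)
    ENNReal.ofReal_ne_top hm.2
  rw [ENNReal.toReal_ofReal (by linarith), SchwartzMap.fourier_coe] at this
  exact this.ne

theorem tsum_fourier_ne_top {b : Rd d → ℂ} (hb : ContDiff ℝ ∞ b) (hb' : HasCompactSupport b) :
    ∑' n : Zd d, ‖𝓕 b (latticePt n)‖ₑ ^ (1 : ℝ) ≠ ⊤ := by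
  obtain ⟨S, hS, h⟩ := exists_tsum_enorm_le (𝓕 (hb'.toSchwartzMap hb) : SchwartzMap (Rd d) ℂ)
  have := h 0
  simp only [sub_zero, SchwartzMap.fourier_coe] at this
  simp only [ENNReal.rpow_one]
  exact ne_top_of_le_ne_top hS this

theorem shiftSum_eq_comp_sub (Q : ℕ) (g : Rd d → ℂ) (w : Td d) :
    shiftSum Q g w = fun t => shiftSum Q g 0 (t - w) := by
  ext t
  simp only [shiftSum, sub_zero]
  exact Finset.sum_congr rfl fun b _ => by rw [sub_right_comm]

theorem innerCut_dilate_support {Q : ℕ} (hQ : Q ≠ 0) {ξ : Rd d}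
    (h : dilate Q (innerCut d) ξ ≠ 0) : ‖ξ‖ ≤ 1 / 4 := by
  by_contra hlt
  refine h (innerCut_eq_zero ?_)
  rw [norm_smul, Real.norm_natCast]
  have : (1 : ℝ) ≤ Q := by exact_mod_cast Nat.one_le_iff_ne_zero.2 hQ
  nlinarith [norm_nonneg ξ]

/-- The operator on `ℤ^d` with multiplier `∑_{b ∈ ℕ_Q^d} Θ(ξ - b/Q)`, localized near the points
`b/Q`, on finitely supported functions. -/
theorem exists_shiftSum_bound (d : ℕ) {p : ℝ} (hp : 1 < p) :
    ∃ C : ℝ≥0∞, C ≠ ⊤ ∧ ∀ (Θ : Rd d → ℂ) (A : ℝ), MultiplierBound Θ p A → ∀ Q : ℕ, Q ≠ 0 →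
      ∀ (S : Finset (Zd d)) (h : Zd d → ℂ),
        ∑' n : Zd d, ‖∑ m ∈ S, UnitAddTorus.mFourierCoeff
          (shiftSum Q (fun ξ => Θ ξ * dilate Q (innerCut d) ξ) 0) (n - m) * h m‖ₑ ^ p ≤
        C * ENNReal.ofReal A ^ p * ∑ m ∈ S, ‖h m‖ₑ ^ p := by
  obtain ⟨C, hC, hT⟩ := exists_transference d hp
  refine ⟨C, hC, fun Θ A hΘ Q hQ => ?_⟩
  have : NeZero Q := ⟨hQ⟩
  have hsupp : ∀ ξ : Rd d, 1 / 2 ≤ ‖ξ‖ → Θ ξ * dilate Q (innerCut d) ξ = 0 := by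
    intro ξ hξ
    by_contra h
    linarith [innerCut_dilate_support hQ (right_ne_zero_of_mul h)]
  have hi := hΘ.integrable (contDiff_dilate (contDiff_innerCut (d := d)) Q)
    (hasCompactSupport_dilate hasCompactSupport_innerCut hQ)
  have hone : ∀ n : Zd d, UnitAddTorus.mFourier n (0 : Td d) = 1 := by
    intro n; simp [UnitAddTorus.mFourier]
  refine tsum_convolution_le_of_residues (Q := Q) (κ := fun n => (Q : ℂ) ^ d *
    𝓕 (fun ξ => Θ ξ * dilate Q (innerCut d) ξ) (latticePt ((Q : ℤ) • n))) ?_ ?_ (by linarith)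
    (hT Θ A hΘ Q hQ)
  · intro n hn
    rw [mFourierCoeff_shiftSum hsupp hi hQ, if_neg hn, mul_zero, zero_mul]
  · intro n
    rw [mFourierCoeff_shiftSum hsupp hi hQ, if_pos (fun i => (Dvd.intro (n i) rfl : (Q : ℤ) ∣ ((Q : ℤ) • n) i)), hone, one_mul]

end Kernels

/-! ### The scaled cutoff -/

section Cutoff

variable {d : ℕ} {η : Rd d → ℝ} {ε : Fin d → ℝ}

theorem IsCutoff.contDiff_scaledCutoff (hη : IsCutoff d η) :
    ContDiff ℝ ∞ fun ζ => (scaledCutoff η ε ζ : ℂ) := by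
  refine Complex.ofRealCLM.contDiff.comp (hη.smooth.comp ?_)
  rw [contDiff_euclidean]
  intro i
  exact contDiff_const.mul (contDiff_euclidean.1 contDiff_id i)

/-- Since `Q ≤ (ε i)⁻¹`, the vector `Qξ` is coordinatewise dominated by `𝓔⁻¹ξ`, which has norm at
most `1/(8d)` on the support. -/
theorem IsCutoff.norm_smul_le (hd : 1 ≤ d) (hη : IsCutoff d η) {Q : ℕ}
    (hε : ∀ i, 0 < ε i ∧ Q * ε i ≤ 1) {ξ : Rd d} (hξ : (scaledCutoff η ε ξ : ℂ) ≠ 0) :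
    ‖(Q : ℝ) • ξ‖ ≤ 1 / 8 := by
  have h1 : ‖(WithLp.toLp 2 fun i => (ε i)⁻¹ * ξ i : Rd d)‖ ≤ 1 / (8 * d) := by
    by_contra hlt
    exact hξ (by rw [scaledCutoff, hη.eq_zero _ (not_le.1 hlt).le, Complex.ofReal_zero])
  have h2 : (1 : ℝ) / (8 * d) ≤ 1 / 8 := by
    have : (1 : ℝ) ≤ d := by exact_mod_cast hd
    gcongr
    linarith
  refine le_trans ?_ (h1.trans h2)
  rw [EuclideanSpace.norm_eq, EuclideanSpace.norm_eq]
  gcongr with i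
  simp only [PiLp.smul_apply, smul_eq_mul, norm_mul]
  gcongr
  rw [norm_inv, Real.norm_of_nonneg (hε i).1.le, Real.norm_natCast, ← one_div,
    le_div_iff₀ (hε i).1]
  exact (hε i).2

theorem IsCutoff.hasCompactSupport_scaledCutoff (hd : 1 ≤ d) (hη : IsCutoff d η)
    (hε : ∀ i, 0 < ε i ∧ ((1 : ℕ) : ℝ) * ε i ≤ 1) :
    HasCompactSupport fun ζ => (scaledCutoff η ε ζ : ℂ) := by
  refine HasCompactSupport.intro (isCompact_closedBall (0 : Rd d) (1 / 8)) fun ξ hξ => ?_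
  by_contra h
  have := hη.norm_smul_le hd hε h
  exact hξ (by simpa using this)

end Cutoff

/-! ### The square function estimate -/

section SquareFunction

variable {d : ℕ}

theorem squareFn_self {k : ℕ} {β : Fin k → ℕ} (q : (j : Fin k) → Fin (β j) → ℕ)
    (M : Finset (Fin k)) (σ : (j : M) → Fin (β j)) (F : Td d → Zd d → ℂ) (x : Zd d) :
    squareFn d q M M σ F x =
      Real.sqrt (∑ w : U d q Mᶜ, ‖∑ v ∈ V d q M σ, F (w + v) x‖ ^ 2) := by
  have h0 : U d q (M \ M) = {0} := by
    ext x
    rw [mem_U, Finset.mem_singleton, Finset.sdiff_self]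
    simp [eq_comm]
  rw [squareFn, h0]
  simp only [Finset.sum_singleton, add_zero]
  rw [← Finset.sum_coe_sort (U d q Mᶜ)]

theorem eLpNorm_sqrt_count {r : ℕ} (hr : 1 ≤ r) {S : Zd d → ℝ} (hS : ∀ x, 0 ≤ S x) :
    eLpNorm (fun x => Real.sqrt (S x)) (2 * (r : ℝ≥0∞)) Measure.count =
      (∑' x, ENNReal.ofReal (S x ^ r)) ^ (1 / (2 * (r : ℝ))) := by
  have hr0 : (r : ℝ≥0∞) ≠ 0 := by positivity
  have ht : (2 * (r : ℝ≥0∞)).toReal = ((2 * r : ℕ) : ℝ) := by simp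
  rw [eLpNorm_eq_lintegral_rpow_enorm_toReal (by positivity) (by finiteness), lintegral_count, ht]
  congr 2
  · ext x
    rw [ENNReal.rpow_natCast, ← ofReal_norm, ← ENNReal.ofReal_pow (norm_nonneg _),
      Real.norm_of_nonneg (Real.sqrt_nonneg _), pow_mul, Real.sq_sqrt (hS x)]
  · push_cast; rfl

theorem enorm_latticeMult_le (m : Td d → ℂ) (f : Zd d → ℂ) (x : Zd d) :
    ‖latticeMult m f x‖ₑ ≤ ∑' y, ‖UnitAddTorus.mFourierCoeff m (x - y)‖ₑ * ‖f y‖ₑ := by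
  refine enorm_tsum_le_tsum_enorm.trans (le_of_eq ?_)
  simp only [enorm_mul]

end SquareFunction

/-! ### Summability, and the estimate for torsion frequencies. -/

section Main

variable {d : ℕ} {Θ e : Rd d → ℂ}

theorem summable_mFourierCoeff_mul {m : Td d → ℂ} {f : Zd d → ℂ} {p q : ℝ}
    (hpq : p.HolderConjugate q) (hm : ∑' n, ‖UnitAddTorus.mFourierCoeff m n‖ₑ ^ q ≠ ⊤)
    (hf : ∑' n, ‖f n‖ₑ ^ p ≠ ⊤) (x : Zd d) :
    Summable fun y => UnitAddTorus.mFourierCoeff m (x - y) * f y := by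
  refine summable_of_tsum_enorm_ne_top ?_
  simp only [enorm_mul]
  refine tsum_mul_lt_top hpq ?_ hf
  rwa [← (Equiv.subLeft x).tsum_eq] at hm

theorem tsum_latticeMult_rpow_ne_top {m : Td d → ℂ} {f : Zd d → ℂ} {p : ℝ} (hp : 1 < p)
    (hm : ∑' n, ‖UnitAddTorus.mFourierCoeff m n‖ₑ ≠ ⊤) (hf : ∑' n, ‖f n‖ₑ ^ p ≠ ⊤) :
    ∑' n, ‖latticeMult m f n‖ₑ ^ p ≠ ⊤ := by
  refine ne_top_of_le_ne_top ?_ ((ENNReal.tsum_le_tsum fun n => ENNReal.rpow_le_rpow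
    (enorm_latticeMult_le m f n) (by linarith)).trans
    (tsum_convolution_rpow_le hp (fun n => ‖UnitAddTorus.mFourierCoeff m n‖ₑ) fun n => ‖f n‖ₑ))
  exact ENNReal.mul_ne_top (ENNReal.mul_ne_top
    (ENNReal.rpow_ne_top_of_nonneg (by linarith) hm) hm) hf

theorem summable_mFourierCoeff_mul_of_summable {m : Td d → ℂ} {f : Zd d → ℂ} {p q : ℝ}
    (hpq : p.HolderConjugate q) (hm : ∑' n, ‖UnitAddTorus.mFourierCoeff m n‖ₑ ≠ ⊤)
    (hf : ∑' n, ‖f n‖ₑ ^ p ≠ ⊤) (x : Zd d) :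
    Summable fun y => UnitAddTorus.mFourierCoeff m (x - y) * f y := by
  have h := tsum_convolution_rpow_le hpq.lt
    (fun n => ‖UnitAddTorus.mFourierCoeff m n‖ₑ) fun n => ‖f n‖ₑ
  have h1 := ne_top_of_le_ne_top (ENNReal.mul_ne_top (ENNReal.mul_ne_top
    (ENNReal.rpow_ne_top_of_nonneg (by linarith [hpq.lt]) hm) hm) hf) h
  have h2 := ne_top_of_le_ne_top h1 (ENNReal.le_tsum x)
  refine summable_of_tsum_enorm_ne_top ?_
  simp only [enorm_mul]
  intro htop
  exact h2 (by rw [htop, ENNReal.top_rpow_of_pos hpq.pos])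

/-- The square function estimate for a finite family of frequencies `w i`, and a set `s` of
`Q`-torsion points. -/
theorem tsum_sq_latticeMult_le {r : ℕ} (hr : 1 ≤ r) {q B : ℝ} (hB0 : 0 ≤ B)
    (hpq : ((2 * r : ℕ) : ℝ).HolderConjugate q) {A : ℝ} (hΘ : MultiplierBound Θ q A)
    (he : ContDiff ℝ ∞ e) (he' : HasCompactSupport e) {Q Q' : ℕ} (hQ : Q ≠ 0) (hQ' : Q' ≠ 0)
    (hdvd : Q' ∣ Q) (hsupp : ∀ ξ, e ξ ≠ 0 → ‖(Q : ℝ) • ξ‖ ≤ 1 / 8)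
    (hB : ∀ (S : Finset (Zd d)) (h : Zd d → ℂ),
      ∑' n : Zd d, ‖∑ m ∈ S, UnitAddTorus.mFourierCoeff
          (shiftSum Q (fun ξ => Θ ξ * dilate Q (innerCut d) ξ) 0) (n - m) * h m‖ₑ ^
            ((2 * r : ℕ) : ℝ) ≤
        ENNReal.ofReal B * ∑ m ∈ S, ‖h m‖ₑ ^ ((2 * r : ℕ) : ℝ))
    {f : Zd d → ℂ} (hf : ∑' n, ‖f n‖ₑ ^ ((2 * r : ℕ) : ℝ) ≠ ⊤)
    {ι : Type*} [Fintype ι] (w : ι → Td d) (s : Finset (Td d)) (hs : ∀ v ∈ s, Q • v = 0) :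
    ∑' x, ENNReal.ofReal ((∑ i, ‖∑ v ∈ s,
        latticeMult (shiftSum Q' (fun ξ => Θ ξ * e ξ) (w i + v)) f x‖ ^ 2) ^ r) ≤
      ENNReal.ofReal (B * khinchineConst r) * ∑' x, ENNReal.ofReal ((∑ i, ‖∑ v ∈ s,
        latticeMult (shiftSum Q' e (w i + v)) f x‖ ^ 2) ^ r) := by
  have hQ1 : (1 : ℝ) ≤ Q := by exact_mod_cast Nat.one_le_iff_ne_zero.2 hQ
  have hsupp' : ∀ ξ, e ξ ≠ 0 → ‖ξ‖ ≤ 1 / 8 := by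
    intro ξ hξ
    have := hsupp ξ hξ
    rw [norm_smul, Real.norm_natCast] at this
    nlinarith [norm_nonneg ξ]
  have he4 : ∀ ξ, 1 / 4 ≤ ‖ξ‖ → e ξ = 0 := fun ξ hξ => by
    by_contra h; linarith [hsupp' ξ h]
  have he2 : ∀ ξ, 1 / 2 ≤ ‖ξ‖ → e ξ = 0 := fun ξ hξ => he4 ξ (by linarith)
  have hΘe2 : ∀ ξ, 1 / 2 ≤ ‖ξ‖ → Θ ξ * e ξ = 0 := fun ξ hξ => by rw [he2 ξ hξ, mul_zero]
  have hei : Integrable e := he.continuous.integrable_of_hasCompactSupport he'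
  have hΘei := hΘ.integrable he he'
  set c := dilate Q (innerCut d) with hc
  have hcsm : ContDiff ℝ ∞ c := contDiff_dilate contDiff_innerCut Q
  have hccs : HasCompactSupport c := hasCompactSupport_dilate hasCompactSupport_innerCut hQ
  have hΘc2 : ∀ ξ, 1 / 2 ≤ ‖ξ‖ → Θ ξ * c ξ = 0 := by
    intro ξ hξ
    by_contra h
    linarith [innerCut_dilate_support hQ (right_ne_zero_of_mul h)]
  have hΘci := hΘ.integrable hcsm hccs
  have hq1 : 1 < q := hpq.symm.lt
  -- `K i`, `E i` and `g i` are the outer multiplier, the inner multiplier and its output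
  set K : ι → Td d → ℂ := fun i => shiftSum Q (fun ξ => Θ ξ * c ξ) (w i) with hK
  set E : ι → Td d → ℂ := fun i ξ => ∑ v ∈ s, shiftSum Q' e (w i + v) ξ with hE
  have hEc : ∀ i, Continuous (E i) := fun i =>
    continuous_finsetSum _ fun v _ => continuous_shiftSum he.continuous he4 Q' _
  have hkq : ∀ u, ∑' n, ‖UnitAddTorus.mFourierCoeff
      (shiftSum Q (fun ξ => Θ ξ * c ξ) u) n‖ₑ ^ q ≠ ⊤ := fun u =>
    tsum_mFourierCoeff_shiftSum_ne_top hΘc2 hΘci hQ (by linarith)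
      (hΘ.tsum_fourier_ne_top hq1 hcsm hccs fun ξ hξ => innerCut_dilate_support hQ hξ) u
  have hΘeq : ∀ u, ∑' n, ‖UnitAddTorus.mFourierCoeff
      (shiftSum Q' (fun ξ => Θ ξ * e ξ) u) n‖ₑ ^ q ≠ ⊤ := fun u =>
    tsum_mFourierCoeff_shiftSum_ne_top hΘe2 hΘei hQ' (by linarith)
      (hΘ.tsum_fourier_ne_top hq1 he he' fun ξ hξ => (hsupp' ξ hξ).trans (by norm_num)) u
  have he1 : ∀ u, ∑' n, ‖UnitAddTorus.mFourierCoeff (shiftSum Q' e u) n‖ₑ ≠ ⊤ := fun u => by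
    simpa only [ENNReal.rpow_one] using
      tsum_mFourierCoeff_shiftSum_ne_top he2 hei hQ' one_pos (tsum_fourier_ne_top he he') u
  have hE1 : ∀ i, ∑' n, ‖UnitAddTorus.mFourierCoeff (E i) n‖ₑ ≠ ⊤ := by
    intro i
    refine ne_top_of_le_ne_top (b := ∑ v ∈ s, ∑' n,
      ‖UnitAddTorus.mFourierCoeff (shiftSum Q' e (w i + v)) n‖ₑ) ?_ ?_
    · exact ENNReal.sum_ne_top.2 fun v _ => he1 _
    · rw [← Summable.tsum_finsetSum fun _ _ => ENNReal.summable]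
      refine ENNReal.tsum_le_tsum fun n => ?_
      rw [hE, mFourierCoeff_sum s fun v _ => integrable_shiftSum he2 hei Q' _]
      exact enorm_sum_le _ _
  set g : ι → Zd d → ℂ := fun i => latticeMult (E i) f with hg
  have hg_eq : ∀ i x, ∑ v ∈ s, latticeMult (shiftSum Q' e (w i + v)) f x = g i x := by
    intro i x
    rw [hg, ← latticeMult_sum s (fun v _ => integrable_shiftSum he2 hei Q' _)]
    exact fun v _ => summable_mFourierCoeff_mul_of_summable hpq (he1 _) hf x
  have hG_eq : ∀ i x, ∑ v ∈ s, latticeMult (shiftSum Q' (fun ξ => Θ ξ * e ξ) (w i + v)) f x =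
      latticeMult (K i) (g i) x := by
    intro i x
    rw [← latticeMult_sum s (fun v _ => integrable_shiftSum hΘe2 hΘei Q' _)
      (fun v _ => summable_mFourierCoeff_mul hpq (hΘeq _) hf x),
      ← latticeMult_mul (integrable_shiftSum hΘc2 hΘci Q _) (hEc i) hpq (hkq _) (hE1 i) hf]
    congr 1
    ext ξ
    exact (shiftSum_mul_sum_shiftSum hQ hsupp hQ' hdvd (w i) ξ s hs).symm
  -- Modulating by `w i` recentres every `K i` at the origin, so that one scalar operator acts on
  -- all components, as the vector-valued extension requires.
  set h : ι → Zd d → ℂ := fun i y => UnitAddTorus.mFourier y (w i) * g i y with hh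
  have hnorm : ∀ i y, ‖h i y‖ = ‖g i y‖ := fun i y => by
    rw [hh, norm_mul, norm_mFourier_apply, one_mul]
  have hhp : ∀ i, ∑' n, ‖h i n‖ₑ ^ ((2 * r : ℕ) : ℝ) ≠ ⊤ := by
    intro i
    have : ∀ n, ‖h i n‖ₑ = ‖g i n‖ₑ := fun n => by rw [← ofReal_norm, hnorm, ofReal_norm]
    simp only [this]
    exact tsum_latticeMult_rpow_ne_top hpq.lt (hE1 i) hf
  have hmain := tsum_squareFn_le hr hB0 hB
    (fun i x => summable_mFourierCoeff_mul hpq (hkq 0) (hhp i) x)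
  simp only [hnorm] at hmain
  simp only [hg_eq, hG_eq]
  refine le_trans (le_of_eq ?_) hmain
  have hKh : ∀ i x, ‖latticeMult (K i) (g i) x‖ =
      ‖latticeMult (shiftSum Q (fun ξ => Θ ξ * c ξ) 0) (h i) x‖ := fun i x => by
    rw [hK, ← norm_latticeMult_comp_sub]
    simp only
    rw [shiftSum_eq_comp_sub]
  simp only [hKh]
  rfl

theorem Q0_mul_mem_PN {ρ : ℝ} {N n : ℕ}
    (hn : n ∈ PiSet (bigD ρ) (primesN ρ N) ∪ {1}) : Q0 ρ N * n ∈ PN ρ N :=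
  ⟨Q0 ρ N, n, dvd_rfl, hn, rfl⟩

theorem tsum_enorm_rpow_ne_top_of_memℓp {r : ℕ} (hr : 1 ≤ r) {f : Zd d → ℂ}
    (hf : Memℓp f (2 * (r : ℝ≥0∞))) : ∑' n, ‖f n‖ₑ ^ ((2 * r : ℕ) : ℝ) ≠ ⊤ := by
  have ht : (2 * (r : ℝ≥0∞)).toReal = ((2 * r : ℕ) : ℝ) := by simp
  have hs := hf.summable (by rw [ht]; positivity)
  rw [ht] at hs
  have h1 : ∀ n, ‖f n‖ₑ ^ ((2 * r : ℕ) : ℝ) = ENNReal.ofReal (‖f n‖ ^ ((2 * r : ℕ) : ℝ)) := by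
    intro n
    rw [← ofReal_norm, ENNReal.ofReal_rpow_of_nonneg (norm_nonneg _) (by positivity)]
  simp only [h1]
  exact hs.tsum_ofReal_ne_top

end Main

end IonescuWainger

end

/-! ### The proposition. -/

theorem proposition2p7 (d : ℕ) (hd : 1 ≤ d) (ρ : ℝ) (hρ : 0 < ρ) (r : ℕ) (hr : 1 ≤ r) :
    ∃ C : ℝ, 0 < C ∧
      ∀ (η : IonescuWainger.Rd d → ℝ), IonescuWainger.IsCutoff d η →
      ∀ (Θ : IonescuWainger.Rd d → ℂ) (A : ℝ → ℝ),
        (∀ p : ℝ, 1 < p → 0 < A p ∧ IonescuWainger.MultiplierBound Θ p (A p)) →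
      ∀ N : ℕ, (8 : ℝ) ^ (2 * (r : ℝ) / ρ) < (N : ℝ) →
        (∀ n ∈ IonescuWainger.PN ρ N, (n : ℝ) ≤ Real.exp ((N : ℝ) ^ ρ)) →
      ∀ ε : Fin d → ℝ, (∀ i, 0 < ε i ∧ ε i ≤ Real.exp (-(N : ℝ) ^ (2 * ρ))) →
      ∀ Λ : Set ℕ,
        Λ ⊆ IonescuWainger.PiSet (IonescuWainger.bigD ρ) (IonescuWainger.primesN ρ N) ∪ {1} →
      ∀ (k : ℕ) (β : Fin k → ℕ) (q : (j : Fin k) → Fin (β j) → ℕ),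
        IonescuWainger.IsOSystem (IonescuWainger.bigD ρ) (IonescuWainger.primesN ρ N) Λ k β q →
      ∀ f : IonescuWainger.Zd d → ℂ, Memℓp f (2 * (r : ℝ≥0∞)) →
        (∀ u ∈ IonescuWainger.U d q Finset.univ, ∀ x : IonescuWainger.Zd d,
          Summable fun y : IonescuWainger.Zd d =>
            UnitAddTorus.mFourierCoeff
              (IonescuWainger.mult q Λ (IonescuWainger.Q0 ρ N) Θ
                (IonescuWainger.scaledCutoff η ε) u) (x - y) * f y) ∧
        ∀ (M : Finset (Fin k)) (σ : (j : M) → Fin (β j)),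
          eLpNorm
              (IonescuWainger.squareFn d q M M σ fun u =>
                IonescuWainger.latticeMult
                  (IonescuWainger.mult q Λ (IonescuWainger.Q0 ρ N) Θ
                    (IonescuWainger.scaledCutoff η ε) u) f)
              (2 * (r : ℝ≥0∞)) Measure.count ≤
            ENNReal.ofReal (C * A (2 * (r : ℝ))) *
              eLpNorm
                (IonescuWainger.squareFn d q M M σ fun u =>
                  IonescuWainger.latticeMult
                    (IonescuWainger.shiftSum (IonescuWainger.Q0 ρ N)
                      (fun ζ => (IonescuWainger.scaledCutoff η ε ζ : ℂ)) u) f)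
                (2 * (r : ℝ≥0∞)) Measure.count := by
  open IonescuWainger in
  have hp1 : (1 : ℝ) < ((2 * r : ℕ) : ℝ) := by
    have : 1 < 2 * r := by omega
    exact_mod_cast this
  have hpcast : (2 * (r : ℝ)) = ((2 * r : ℕ) : ℝ) := by push_cast; rfl
  obtain ⟨C, hC, hCb⟩ := exists_shiftSum_bound d hp1
  -- The summand `1` keeps the constant positive if `C = 0`; the `2r`-th root taken below is due to
  -- estimating `2r`-th powers.
  set C₀ : ℝ := C.toReal * khinchineConst r + 1 with hC₀
  have hκ := khinchineConst_pos r
  have hC₀pos : 0 < C₀ := by positivity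
  refine ⟨C₀ ^ (1 / (2 * (r : ℝ))), Real.rpow_pos_of_pos hC₀pos _, ?_⟩
  intro η hη Θ A hA N hN hPN ε hε Λ hΛ k β q hO f hf
  have hP : ∀ p ∈ primesN ρ N, p.Prime := fun p hp => hp.1
  have hf' := tsum_enorm_rpow_ne_top_of_memℓp hr hf
  have hpq : ((2 * r : ℕ) : ℝ).HolderConjugate (Real.conjExponent ((2 * r : ℕ) : ℝ)) :=
    Real.HolderConjugate.conjExponent hp1
  set p' := Real.conjExponent ((2 * r : ℕ) : ℝ)
  have hp'1 : 1 < p' := hpq.symm.lt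
  have hΘq := (hA p' hp'1).2
  have hA0 : 0 < A (2 * (r : ℝ)) := (hA _ (hpcast ▸ hp1)).1
  have hΘp : MultiplierBound Θ ((2 * r : ℕ) : ℝ) (A (2 * (r : ℝ))) := by
    have := (hA _ hp1).2
    rwa [← hpcast] at this ⊢
  have hN1 : (1 : ℝ) ≤ N := by
    refine le_trans ?_ hN.le
    exact Real.one_le_rpow (by norm_num) (by positivity)
  -- As `N ≥ 1`, the size bound on `P_N` and the bound on `ε` multiply to `e^{N^ρ - N^{2ρ}} ≤ 1`.
  have hεQ : ∀ n ∈ PN ρ N, ∀ i, 0 < ε i ∧ (n : ℝ) * ε i ≤ 1 := by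
    intro n hn i
    refine ⟨(hε i).1, ?_⟩
    have h1 : (N : ℝ) ^ ρ ≤ (N : ℝ) ^ (2 * ρ) :=
      Real.rpow_le_rpow_of_exponent_le hN1 (by linarith)
    calc (n : ℝ) * ε i ≤ Real.exp ((N : ℝ) ^ ρ) * Real.exp (-(N : ℝ) ^ (2 * ρ)) :=
          mul_le_mul (hPN n hn) (hε i).2 (hε i).1.le (Real.exp_pos _).le
      _ ≤ 1 := by
          rw [← Real.exp_add, Real.exp_le_one_iff]
          linarith
  have hQ0 : Q0 ρ N ≠ 0 := pow_ne_zero _ (Nat.factorial_ne_zero _)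
  set e : Rd d → ℂ := fun ζ => (scaledCutoff η ε ζ : ℂ) with he
  have hesm : ContDiff ℝ ∞ e := hη.contDiff_scaledCutoff
  have hε1 : ∀ i, 0 < ε i ∧ ((1 : ℕ) : ℝ) * ε i ≤ 1 := by
    refine hεQ 1 ⟨1, 1, one_dvd _, Or.inr rfl, rfl⟩
  have hecs : HasCompactSupport e := hη.hasCompactSupport_scaledCutoff hd hε1
  have he8 : ∀ ξ, e ξ ≠ 0 → ‖ξ‖ ≤ 1 / 8 := fun ξ hξ => by
    simpa using hη.norm_smul_le hd hε1 hξ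
  have hmult : ∀ u, mult q Λ (Q0 ρ N) Θ (scaledCutoff η ε) u =
      fun ξ => chi d q Λ u * shiftSum (Q0 ρ N) (fun ζ => Θ ζ * e ζ) u ξ := fun u => rfl
  refine ⟨fun u _ x => ?_, fun M σ => ?_⟩
  · have h1 := summable_mFourierCoeff_mul (m := shiftSum (Q0 ρ N) (fun ζ => Θ ζ * e ζ) u) hpq
      (tsum_mFourierCoeff_shiftSum_ne_top (fun ξ hξ => ?_) (hΘq.integrable hesm hecs) hQ0
        (by linarith) (hΘq.tsum_fourier_ne_top hp'1 hesm hecs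
          fun ξ hξ => (he8 ξ hξ).trans (by norm_num)) u) hf' x
    · simp only [hmult, mFourierCoeff_const_mul, mul_assoc]
      exact h1.mul_left _
    · by_contra h
      linarith [he8 ξ (right_ne_zero_of_mul h)]
  -- The modulus of the outer multiplier is `Q0 * n`: it kills both the shifts `b/Q₀` and all of
  -- `𝓥_M^σ`, and still lies in `P_N`.
  · set n := ∏ j : M, q j (σ j) with hn
    have hnPN : Q0 ρ N * n ∈ PN ρ N := Q0_mul_mem_PN (hO.prod_mem_PiSet hP M σ)
    have hn0 : n ≠ 0 := Finset.prod_ne_zero_iff.2 fun j _ =>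
      (Nat.zero_lt_of_lt (hO.one_lt hP _ _)).ne'
    have hQ : Q0 ρ N * n ≠ 0 := mul_ne_zero hQ0 hn0
    have hV : ∀ v ∈ V d q M σ, (Q0 ρ N * n) • v = 0 := by
      intro v hv
      rw [mul_nsmul', hO.nsmul_of_mem_V hP hv, smul_zero]
    set a := A (2 * (r : ℝ)) with ha
    have hBeq : C * ENNReal.ofReal a ^ ((2 * r : ℕ) : ℝ) =
        ENNReal.ofReal (C.toReal * a ^ (2 * r)) := by
      rw [ENNReal.ofReal_mul ENNReal.toReal_nonneg, ENNReal.ofReal_toReal hC,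
        ENNReal.ofReal_pow hA0.le, ENNReal.rpow_natCast]
    have hB := hCb Θ a hΘp (Q0 ρ N * n) hQ
    rw [hBeq] at hB
    have hmain := tsum_sq_latticeMult_le hr (by positivity) hpq hΘq hesm hecs hQ hQ0
      (dvd_mul_right _ _) (fun ξ hξ => hη.norm_smul_le hd (hεQ _ hnPN) hξ) hB hf'
      (fun w : U d q Mᶜ => (w : Td d)) (V d q M σ) hV
    simp only [funext (squareFn_self q M σ _)]
    rw [eLpNorm_sqrt_count hr fun x => Finset.sum_nonneg fun _ _ => sq_nonneg _,
      eLpNorm_sqrt_count hr fun x => Finset.sum_nonneg fun _ _ => sq_nonneg _]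
    have hpos : 0 ≤ 1 / (2 * (r : ℝ)) := by positivity
    have hconst : ENNReal.ofReal (C₀ ^ (1 / (2 * (r : ℝ))) * a) =
        ENNReal.ofReal (C₀ * a ^ (2 * r)) ^ (1 / (2 * (r : ℝ))) := by
      rw [ENNReal.ofReal_rpow_of_nonneg (by positivity) hpos,
        Real.mul_rpow hC₀pos.le (by positivity), ← Real.rpow_natCast a, ← Real.rpow_mul hA0.le,
        ← hpcast, mul_one_div_cancel (by positivity), Real.rpow_one]
    rw [hconst, ← ENNReal.mul_rpow_of_nonneg _ _ hpos]
    refine ENNReal.rpow_le_rpow ?_ hpos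
    -- The common factor `𝟙_Λ`, of modulus at most `1`, is discarded before the main estimate;
    -- afterwards the constant is enlarged to `C₀`.
    refine le_trans (le_trans ?_ hmain) ?_
    · refine ENNReal.tsum_le_tsum fun x => ENNReal.ofReal_le_ofReal ?_
      refine pow_le_pow_left₀ (Finset.sum_nonneg fun _ _ => sq_nonneg _)
        (Finset.sum_le_sum fun w _ => pow_le_pow_left₀ (norm_nonneg _) ?_ 2) r
      obtain ⟨c, hc, hcv⟩ := hO.exists_chi_eq hP M σ w.2
      have : ∑ v ∈ V d q M σ, latticeMult (mult q Λ (Q0 ρ N) Θ (scaledCutoff η ε) (w + v)) f x =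
          c * ∑ v ∈ V d q M σ, latticeMult (shiftSum (Q0 ρ N) (fun ζ => Θ ζ * e ζ) (w + v)) f x := by
        rw [Finset.mul_sum]
        refine Finset.sum_congr rfl fun v hv => ?_
        rw [hmult, latticeMult_const_mul, hcv v hv]
      rw [this, norm_mul]
      exact mul_le_of_le_one_left (norm_nonneg _) hc
    · refine mul_le_mul_left (ENNReal.ofReal_le_ofReal ?_) _
      rw [hC₀]
      have : 0 ≤ a ^ (2 * r) := pow_nonneg hA0.le _
      linarith
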